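/- Let $1\le k\le 11$ be an integer and $R$ a nonzero real number, so that $\lambda=\tfrac14+R^2>\tfrac14$. For $g=\begin{pmatrix}a&b\\c&d\end{pmatrix}\in SL(2,\mathbb Z)$ let $v_\eta(g)$ be the eta multiplier, defined by $\eta(gz)=v_\eta(g)(cz+d)^{1/2}\eta(z)$ (principal branch), where $\eta$ is the Dedekind eta function, and put $v=v_\eta^{2k}$. For a multiplier system $w\in\{v,\overline v\}$ let $\mathcal M(w,k,R)$ be the space of Maass waveforms of weight $k$, multiplier $w$ and spectral parameter $R$ on the upper half-plane $\mathbb H$, that is, of smooth functions $f:\mathbb H\to\mathbb C$ with $$e^{-ik\operatorname{Arg}(cz+d)}f(gz)=w(g)f(z)\quad\text{for all } g\in SL(2,\mathbb Z),$$ $$y^2\Big(\frac{\partial^2 f}{\partial x^2}+\frac{\partial^2 f}{\partial y^2}\Big)-iky\frac{\partial f}{\partial x}+\Big(\frac14+R^2\Big)f=0,\qquad \int_{SL(2,\mathbb Z)\backslash\mathbb H}|f|^2\,\frac{dx\,dy}{y^2}<\infty .$$ For an integer $m$ let $E_m^-=(z-\overline z)\frac{\partial}{\partial\overline z}+\frac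 m2$ be the Maass lowering operator, let $(Jf)(z)=f(-\overline z)$, and let $$\Theta=J\circ E_{2-k}^-\circ\cdots\circ E_{k-2}^-\circ E_k^-$$ (with $k$ lowering operators). Put $$\Lambda_{k,R}=\begin{cases}\prod_{j=1}^{l}\big(j(j-1)+\frac14+R^2\big)^2,&k=2l,\\[2pt]-R^2\prod_{j=1}^{l}\big(j^2+R^2\big)^2,&k=2l+1.\end{cases}$$ For $n\in\mathbb Z$, $z=x+iy\in\mathbb H$ and a nonzero real number $\beta$ put $$w_\beta(z)=|\beta|^{-1/2}\,W_{\frac k2\operatorname{sgn}\beta,\,iR}(4\pi|\beta|y)\,e^{2\pi i\beta x},$$ $\mathcal W_{n,k,R}=w_{n+k/12}$ and $\mathcal W^*_{n,k,R}=w_{n-k/12}$, where $W_{\kappa,\mu}$ is the Whittaker $W$-function. Then: 1. $\Theta$ is a bijection from $\mathcal M(v,k,R)$ onto $\mathcal M(\overline v,k,R)$, and also a bijection from $\mathcal M(\overline v,k,R)$ onto $\mathcal M(v,k,R)$. 2. $\Theta^2 f=\Lambda_{k,R}f$ for every $f\in\mathcal M(v,k,R)$ and for every $f\in\mathcal M(\overline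 v,k,R)$. 3. If $f\in\mathcal M(v,k,R)$ has the Fourier expansion $f(z)=\sum_{n\in\mathbb Z}c(n)\mathcal W_{n,k,R}(z)$ (converging unconditionally at every $z\in\mathbb H$), then, with convergence in the same sense, $$\Theta f(z)=\sum_{n\in\mathbb Z}\delta_n\,c(-n)\,\mathcal W^*_{n,k,R}(z),\qquad \delta_n=\begin{cases}1,&n\ge1,\\ \Lambda_{k,R},&n\le0.\end{cases}$$ -/

import Mathlib

namespace EtaMaass

open UpperHalfPlane ModularForm MatrixGroups ComplexConjugate

noncomputable section

/-- The automorphy factor `j_g(z; k) = exp (i k Arg (c z + d))`, for `g = (a b; c d)` in `SL(2, ℤ)`,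
with the principal argument in `(-π, π]`. -/
def autFactor (k : ℤ) (g : SL(2, ℤ)) (z : ℍ) : ℂ :=
  Complex.exp (Complex.I * k * Complex.arg (denom g z))

/-- The weight `k` slash action `f ↦ j_g(z; k)⁻¹ f (g z)` on functions on the upper half-plane. -/
def slash (k : ℤ) (g : SL(2, ℤ)) (f : ℍ → ℂ) (z : ℍ) : ℂ :=
  (autFactor k g z)⁻¹ * f (g • z)

/-- The eta multiplier system: `v_η(g) = η(g z) / ((c z + d) ^ (1/2) η(z))` with the principal
square root. The quotient does not depend on `z` (see `eta_smul` below), so it is read off at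
`z = i`. -/
def etaMult (g : SL(2, ℤ)) : ℂ :=
  ModularForm.eta ↑(g • UpperHalfPlane.I) /
    ((denom g UpperHalfPlane.I) ^ (1 / 2 : ℂ) * ModularForm.eta ↑UpperHalfPlane.I)

theorem continuous_sqrt_denom (g : SL(2, ℤ)) :
    Continuous fun z : ℍ => (denom g z) ^ (1 / 2 : ℂ) := by
  have hd : ∀ z : ℍ, denom g z = (g 1 0 : ℂ) * z + (g 1 1 : ℂ) := fun z => by
    simp [denom]
  simp only [hd]
  by_cases hc : g 1 0 = 0
  · simpa [hc] using continuous_const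
  · refine Continuous.cpow (by fun_prop) continuous_const fun z => ?_
    refine Complex.mem_slitPlane_iff.mpr (Or.inr ?_)
    simpa using ⟨hc, z.im_ne_zero⟩

theorem discriminant_smul (g : SL(2, ℤ)) (z : ℍ) :
    ModularForm.eta ↑(g • z) ^ 24 = denom g z ^ 12 * ModularForm.eta ↑z ^ 24 := by
  have h : (ModularForm.discriminant ∣[(12 : ℤ)] g) z = ModularForm.discriminant z := by
    rw [SlashInvariantForm.slash_action_generators_SL2Z
      ModularForm.discriminant_S_invariant ModularForm.discriminant_T_invariant g]
  have hne : denom g z ^ 12 ≠ 0 := pow_ne_zero _ (denom_ne_zero _ _)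
  rw [SL_slash_apply, zpow_neg, ← div_eq_mul_inv] at h
  have h2 : ModularForm.discriminant (g • z) =
      ModularForm.discriminant z * denom g z ^ 12 := (div_eq_iff hne).mp h
  rw [mul_comm]
  exact h2

/-- The transformation law `η(g z) = v_η(g) (c z + d) ^ (1/2) η(z)`. -/
theorem eta_smul (g : SL(2, ℤ)) (z : ℍ) :
    ModularForm.eta ↑(g • z) =
      etaMult g * (denom g z) ^ (1 / 2 : ℂ) * ModularForm.eta ↑z := by
  have hne : ∀ w : ℍ, ModularForm.eta ↑w ≠ 0 := fun w => ModularForm.eta_ne_zero w.2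
  have hs : ∀ w : ℍ, (denom g w) ^ (1 / 2 : ℂ) ≠ 0 := fun w => by
    rw [Ne, Complex.cpow_eq_zero_iff]
    exact fun h => denom_ne_zero _ _ h.1
  have hs2 : ∀ w : ℍ, ((denom g w) ^ (1 / 2 : ℂ)) ^ 24 = denom g w ^ 12 := fun w => by
    rw [← Complex.cpow_nat_mul, ← Complex.cpow_natCast]
    norm_num
  have heta : Continuous fun w : ℍ => ModularForm.eta ↑w := by
    refine continuous_iff_continuousAt.mpr fun w => ?_
    exact ContinuousAt.comp (f := fun w : ℍ => (w : ℂ))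
      (ModularForm.differentiableAt_eta_of_mem_upperHalfPlaneSet w.2).continuousAt
      UpperHalfPlane.continuous_coe.continuousAt
  let F : ℍ → ℂ := fun w =>
    ModularForm.eta ↑(g • w) / ((denom g w) ^ (1 / 2 : ℂ) * ModularForm.eta ↑w)
  have hF : Continuous F :=
    (heta.comp (continuous_const_smul (g : GL (Fin 2) ℝ))).div ((continuous_sqrt_denom g).mul heta)
      fun w => mul_ne_zero (hs w) (hne w)
  have hF24 : ∀ w, F w ^ 24 = 1 := fun w => by
    simp only [F]
    rw [div_pow, mul_pow, hs2, discriminant_smul]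
    exact div_self (mul_ne_zero (pow_ne_zero _ (denom_ne_zero _ _)) (pow_ne_zero _ (hne w)))
  have hfin : {x : ℂ | x ^ 24 = 1}.Finite := by
    refine ((Polynomial.nthRoots 24 (1 : ℂ)).toFinset.finite_toSet).subset fun x hx => ?_
    simpa [Polynomial.mem_nthRoots] using hx
  have hconst : F z = F UpperHalfPlane.I :=
    isPreconnected_univ.constant_of_mapsTo hfin.isDiscrete hF.continuousOn
      (fun w _ => hF24 w) (Set.mem_univ z) (Set.mem_univ _)
  have hI : etaMult g = F z := hconst.symm
  rw [hI]
  simp only [F]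
  field_simp [hs z, hne z]

/-- The multiplier system `v_η ^ (2 k)` of weight `k`. -/
def etaSystem (k : ℕ) (g : SL(2, ℤ)) : ℂ := etaMult g ^ (2 * k)

/-- The complex conjugate of `v_η ^ (2 k)`. -/
def etaSystemConj (k : ℕ) (g : SL(2, ℤ)) : ℂ := conj (etaSystem k g)

/-- `∂f/∂x` for a function of `z = x + i y` in the upper half-plane. -/
def dx (f : ℍ → ℂ) (z : ℍ) : ℂ := fderiv ℝ (f ∘ ofComplex) (z : ℂ) 1

/-- `∂f/∂y` for a function of `z = x + i y` in the upper half-plane. -/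
def dy (f : ℍ → ℂ) (z : ℍ) : ℂ := fderiv ℝ (f ∘ ofComplex) (z : ℂ) Complex.I

/-- The Wirtinger derivative `∂f/∂z̄ = (∂f/∂x + i ∂f/∂y) / 2`. -/
def dzbar (f : ℍ → ℂ) (z : ℍ) : ℂ := (dx f z + Complex.I * dy f z) / 2

/-- The weight `k` Laplacian `y² (∂²/∂x² + ∂²/∂y²) - i k y ∂/∂x`. -/
def laplacian (k : ℤ) (f : ℍ → ℂ) (z : ℍ) : ℂ :=
  (z.im : ℂ) ^ 2 * (dx (dx f) z + dy (dy f) z) - Complex.I * k * z.im * dx f z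

/-- Maass waveforms for the modular group, of weight `k`, multiplier system `v` and spectral
parameter `R`: smooth solutions of `Δ_k f + (1/4 + R²) f = 0` that satisfy `f|[k,g] = v(g) f` and
are square integrable with respect to `dx dy / y²` on the standard fundamental domain. -/
structure IsMaassWaveform (k : ℤ) (v : SL(2, ℤ) → ℂ) (R : ℝ) (f : ℍ → ℂ) : Prop where
  smooth : ContDiffOn ℝ (⊤ : ℕ∞) (f ∘ ofComplex) {z : ℂ | 0 < z.im}
  slash_eq : ∀ (g : SL(2, ℤ)) (z : ℍ), slash k g f z = v g * f z
  eigen : ∀ z : ℍ, laplacian k f z + (1 / 4 + (R : ℂ) ^ 2) * f z = 0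
  sq_integrable : MeasureTheory.IntegrableOn (fun z : ℍ => ‖f z‖ ^ 2) ModularGroup.fd

/-- The space of Maass waveforms of weight `k`, multiplier system `v`, spectral parameter `R`. -/
def maassSpace (k : ℤ) (v : SL(2, ℤ) → ℂ) (R : ℝ) : Set (ℍ → ℂ) :=
  {f | IsMaassWaveform k v R f}

/-- The Maass lowering operator `E_k^- = (z - z̄) ∂/∂z̄ + k/2`. -/
def lower (k : ℤ) (f : ℍ → ℂ) (z : ℍ) : ℂ :=
  ((z : ℂ) - conj (z : ℂ)) * dzbar f z + (k : ℂ) / 2 * f z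

/-- The composition `E_{k-2(m-1)}^- ∘ ⋯ ∘ E_{k-2}^- ∘ E_k^-` of `m` lowering operators. -/
def lowerIter (k : ℤ) : ℕ → (ℍ → ℂ) → (ℍ → ℂ)
  | 0, f => f
  | m + 1, f => lower (k - 2 * m) (lowerIter k m f)

/-- The point `-z̄`, the mirror image of `z` in the imaginary axis. -/
def mirror (z : ℍ) : ℍ := ⟨-conj (z : ℂ), by simpa using z.im_pos⟩

/-- The reflection operator `(J f)(z) = f(-z̄)`. -/
def reflect (f : ℍ → ℂ) (z : ℍ) : ℂ := f (mirror z)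

/-- `Θ = J ∘ E_{2-k}^- ∘ ⋯ ∘ E_{k-2}^- ∘ E_k^-`, with `k` lowering operators. -/
def Theta (k : ℕ) (f : ℍ → ℂ) : ℍ → ℂ := reflect (lowerIter k k f)

/-- The constant `Λ_{k,R}`, with `k / 2 = l` for `k = 2 l` and for `k = 2 l + 1`. -/
def Lam (k : ℕ) (R : ℝ) : ℝ :=
  if Even k then
    ∏ j ∈ Finset.Icc 1 (k / 2), ((j : ℝ) * ((j : ℝ) - 1) + 1 / 4 + R ^ 2) ^ 2
  else
    -R ^ 2 * ∏ j ∈ Finset.Icc 1 (k / 2), ((j : ℝ) ^ 2 + R ^ 2) ^ 2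

/-- The Whittaker function `M_{κ,μ}(y) = e^{-y/2} y^{μ+1/2} ₁F₁(1/2 + μ - κ; 1 + 2μ; y)`, for
`y > 0` and `2μ` not a negative integer. The factor `Γ(1 + 2μ)` turns Mathlib's regularized
hypergeometric function into `₁F₁`. -/
def whittakerM (κ μ : ℂ) (y : ℝ) : ℂ :=
  Complex.exp (-(y : ℂ) / 2) * (y : ℂ) ^ (μ + 1 / 2) *
    (Complex.Gamma (1 + 2 * μ) *
      Complex.regularizedHGFun {1 / 2 + μ - κ} {1 + 2 * μ} (y : ℂ))

/-- The Whittaker function `W_{κ,μ}(y)`, for `y > 0` and `2μ` not an integer. -/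
def whittakerW (κ μ : ℂ) (y : ℝ) : ℂ :=
  Complex.Gamma (-(2 * μ)) / Complex.Gamma (1 / 2 - μ - κ) * whittakerM κ μ y +
    Complex.Gamma (2 * μ) / Complex.Gamma (1 / 2 + μ - κ) * whittakerM κ (-μ) y

/-- `|β|^{-1/2} W_{(k/2) sgn β, iR}(4π|β|y) e(β x)`, where `e(t) = exp (2πit)`. -/
def fourierTerm (k : ℕ) (R β : ℝ) (z : ℍ) : ℂ :=
  (1 / (√|β| : ℝ) : ℂ) *
    whittakerW (((k : ℝ) / 2 * Real.sign β : ℝ) : ℂ) (Complex.I * R) (4 * Real.pi * |β| * z.im) *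
    Complex.exp (2 * Real.pi * Complex.I * β * z.re)

/-- `𝒲_{n,k,R}`: the `n`-th term of Fourier expansions for the multiplier system `v_η ^ (2 k)`. -/
def expansionTerm (n : ℤ) (k : ℕ) (R : ℝ) (z : ℍ) : ℂ :=
  fourierTerm k R ((n : ℝ) + (k : ℝ) / 12) z

/-- `𝒲*_{n,k,R}`: the `n`-th term of Fourier expansions for the conjugate multiplier system. -/
def expansionTermConj (n : ℤ) (k : ℕ) (R : ℝ) (z : ℍ) : ℂ :=
  fourierTerm k R ((n : ℝ) - (k : ℝ) / 12) z

end

end EtaMaass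

namespace EtaMaass

open UpperHalfPlane ModularForm MatrixGroups ComplexConjugate

noncomputable section

/-! Composing a lowering operator with the adjacent raising operator, in either order, gives minus a
weighted Laplacian plus a constant (`raise_lower`, `lower_raise`). So lowering preserves the
eigenvalue while the weight drops by two, and the automorphy factor drops accordingly
(`lower_smul`). After `k` steps the weight is `-k`; the reflection `z ↦ -z̄` restores weight `k` and
replaces the multiplier by its conjugate (`reflect_smul`, `etaSystem_mirrorConj`). Square
integrability survives each step by a Caccioppoli estimate in the cusp (`integrableOn_fd_lower`).

Reflection turns a lowering operator into minus a raising operator. The second application of `Θ`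
therefore undoes the first one step at a time, each step contributing a scalar `-(R² + (k/2 - i -
1/2)²)`. Their product is `Λ`, which is nonzero since `R ≠ 0`; hence `Θ` is invertible, with inverse
`Λ⁻¹ Θ`.

For the expansion, the Fourier coefficient at frequency `β`, as a function of `y`, is a Whittaker
function, on which lowering acts by a first-order operator in `y`. The contiguous relations show
that it shifts `κ` down by one with the same scalars as above if `β > 0`, and up by one with factor
`1` if `β < 0`. After `k` steps `κ = ±k/2` has become `∓k/2`, and the reflection changes `β` to
`-β`. Since `Θ f` is smooth and quasi-periodic, it is the sum of the Fourier series so obtained. -/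

/-- Smoothness of a function on the upper half-plane. -/
def SmoothOnUpperHalfPlane (f : ℍ → ℂ) : Prop :=
  ContDiffOn ℝ (⊤ : ℕ∞) (f ∘ ofComplex) {z : ℂ | 0 < z.im}

/-- The imaginary part, as a complex valued function. -/
def imC (z : ℍ) : ℂ := (z.im : ℂ)

theorem isOpen_im_pos : IsOpen {z : ℂ | 0 < z.im} :=
  isOpen_lt continuous_const Complex.continuous_im

theorem im_pos_mem_nhds (z : ℍ) : {z : ℂ | 0 < z.im} ∈ nhds (z : ℂ) :=
  isOpen_im_pos.mem_nhds z.im_pos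

theorem coe_ofComplex_of_mem {w : ℂ} (hw : w ∈ {z : ℂ | 0 < z.im}) : ((ofComplex w : ℍ) : ℂ) = w := by
  rw [ofComplex_apply_of_im_pos hw]

namespace SmoothOnUpperHalfPlane

variable {f g : ℍ → ℂ}

theorem contDiffAt (hf : SmoothOnUpperHalfPlane f) (z : ℍ) :
    ContDiffAt ℝ (⊤ : ℕ∞) (f ∘ ofComplex) (z : ℂ) :=
  ContDiffOn.contDiffAt hf (im_pos_mem_nhds z)

theorem differentiableAt (hf : SmoothOnUpperHalfPlane f) (z : ℍ) :
    DifferentiableAt ℝ (f ∘ ofComplex) (z : ℂ) :=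
  (hf.contDiffAt z).differentiableAt (by simp)

theorem continuous (hf : SmoothOnUpperHalfPlane f) : Continuous f := by
  refine continuous_iff_continuousAt.mpr fun z => ?_
  have h := ContinuousAt.comp (f := fun z : ℍ => (z : ℂ)) (hf.contDiffAt z).continuousAt
    UpperHalfPlane.continuous_coe.continuousAt
  refine h.congr (Filter.Eventually.of_forall fun w => ?_)
  simp

theorem fderiv_apply (hf : SmoothOnUpperHalfPlane f) (v : ℂ) :
    SmoothOnUpperHalfPlane fun z => fderiv ℝ (f ∘ ofComplex) (z : ℂ) v := by
  have h : ContDiffOn ℝ (⊤ : ℕ∞) (fderiv ℝ (f ∘ ofComplex)) {z : ℂ | 0 < z.im} :=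
    ContDiffOn.fderiv_of_isOpen hf isOpen_im_pos (by simp)
  refine (h.clm_apply (contDiffOn_const (c := v))).congr fun w hw => ?_
  simp only [Function.comp_apply, coe_ofComplex_of_mem hw]

theorem dx (hf : SmoothOnUpperHalfPlane f) : SmoothOnUpperHalfPlane (dx f) := hf.fderiv_apply 1

theorem dy (hf : SmoothOnUpperHalfPlane f) : SmoothOnUpperHalfPlane (dy f) :=
  hf.fderiv_apply Complex.I

theorem add (hf : SmoothOnUpperHalfPlane f) (hg : SmoothOnUpperHalfPlane g) :
    SmoothOnUpperHalfPlane fun z => f z + g z := ContDiffOn.add hf hg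

theorem mul (hf : SmoothOnUpperHalfPlane f) (hg : SmoothOnUpperHalfPlane g) :
    SmoothOnUpperHalfPlane fun z => f z * g z := ContDiffOn.mul hf hg

theorem const (c : ℂ) : SmoothOnUpperHalfPlane fun _ => c := contDiffOn_const

theorem const_mul (hf : SmoothOnUpperHalfPlane f) (c : ℂ) :
    SmoothOnUpperHalfPlane fun z => c * f z := (const c).mul hf

end SmoothOnUpperHalfPlane

theorem imC_comp_ofComplex_eventuallyEq (z : ℍ) :
    imC ∘ ofComplex =ᶠ[nhds (z : ℂ)] fun w : ℂ => (Complex.ofRealCLM ∘L Complex.imCLM) w := by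
  filter_upwards [im_pos_mem_nhds z] with w hw
  simp [imC, UpperHalfPlane.im, coe_ofComplex_of_mem hw]

theorem smooth_imC : SmoothOnUpperHalfPlane imC := by
  refine ((Complex.ofRealCLM ∘L Complex.imCLM).contDiff.contDiffOn).congr fun w hw => ?_
  exact (imC_comp_ofComplex_eventuallyEq ⟨w, hw⟩).eq_of_nhds

theorem dx_imC (z : ℍ) : dx imC z = 0 := by
  rw [dx, (imC_comp_ofComplex_eventuallyEq z).fderiv_eq, ContinuousLinearMap.fderiv]
  simp

theorem dy_imC (z : ℍ) : dy imC z = 1 := by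
  rw [dy, (imC_comp_ofComplex_eventuallyEq z).fderiv_eq, ContinuousLinearMap.fderiv]
  simp

/-! ### Product rules and commuting derivatives in the coordinates `x`, `y`. -/

section Rules

variable {f g : ℍ → ℂ}

theorem fderiv_add_apply (hf : SmoothOnUpperHalfPlane f) (hg : SmoothOnUpperHalfPlane g) (z : ℍ)
    (v : ℂ) : fderiv ℝ ((fun z => f z + g z) ∘ ofComplex) (z : ℂ) v =
      fderiv ℝ (f ∘ ofComplex) (z : ℂ) v + fderiv ℝ (g ∘ ofComplex) (z : ℂ) v := by
  have := fderiv_add (hf.differentiableAt z) (hg.differentiableAt z)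
  exact congrArg (fun L : ℂ →L[ℝ] ℂ => L v) this

theorem fderiv_mul_apply (hf : SmoothOnUpperHalfPlane f) (hg : SmoothOnUpperHalfPlane g) (z : ℍ)
    (v : ℂ) : fderiv ℝ ((fun z => f z * g z) ∘ ofComplex) (z : ℂ) v =
      f z * fderiv ℝ (g ∘ ofComplex) (z : ℂ) v + g z * fderiv ℝ (f ∘ ofComplex) (z : ℂ) v := by
  have := congrArg (fun L : ℂ →L[ℝ] ℂ => L v)
    (fderiv_mul (hf.differentiableAt z) (hg.differentiableAt z))
  simp only [add_apply, FunLike.coe_smul, Pi.smul_apply, smul_eq_mul, Function.comp_apply,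
    ofComplex_apply] at this
  exact this

theorem dx_add (hf : SmoothOnUpperHalfPlane f) (hg : SmoothOnUpperHalfPlane g) (z : ℍ) :
    dx (fun z => f z + g z) z = dx f z + dx g z := fderiv_add_apply hf hg z 1

theorem dy_add (hf : SmoothOnUpperHalfPlane f) (hg : SmoothOnUpperHalfPlane g) (z : ℍ) :
    dy (fun z => f z + g z) z = dy f z + dy g z := fderiv_add_apply hf hg z Complex.I

theorem dx_mul (hf : SmoothOnUpperHalfPlane f) (hg : SmoothOnUpperHalfPlane g) (z : ℍ) :
    dx (fun z => f z * g z) z = f z * dx g z + g z * dx f z := fderiv_mul_apply hf hg z 1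

theorem dy_mul (hf : SmoothOnUpperHalfPlane f) (hg : SmoothOnUpperHalfPlane g) (z : ℍ) :
    dy (fun z => f z * g z) z = f z * dy g z + g z * dy f z := fderiv_mul_apply hf hg z Complex.I

theorem dx_const (c : ℂ) (z : ℍ) : dx (fun _ => c) z = 0 := by
  have : ((fun _ => c) ∘ ofComplex : ℂ → ℂ) = fun _ => c := rfl
  rw [dx, this]; simp

theorem dy_const (c : ℂ) (z : ℍ) : dy (fun _ => c) z = 0 := by
  have : ((fun _ => c) ∘ ofComplex : ℂ → ℂ) = fun _ => c := rfl
  rw [dy, this]; simp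

theorem dx_const_mul (hf : SmoothOnUpperHalfPlane f) (c : ℂ) (z : ℍ) :
    dx (fun z => c * f z) z = c * dx f z := by
  rw [dx_mul (.const c) hf, dx_const]; ring

theorem dy_const_mul (hf : SmoothOnUpperHalfPlane f) (c : ℂ) (z : ℍ) :
    dy (fun z => c * f z) z = c * dy f z := by
  rw [dy_mul (.const c) hf, dy_const]; ring

theorem dy_dx (hf : SmoothOnUpperHalfPlane f) (z : ℍ) : dy (dx f) z = dx (dy f) z := by
  have hsymm : IsSymmSndFDerivAt ℝ (f ∘ ofComplex) (z : ℂ) :=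
    (hf.contDiffAt z).isSymmSndFDerivAt
    (by simpa using WithTop.coe_le_coe.mpr (le_top : (2 : ℕ∞) ≤ ⊤))
  have hd : DifferentiableAt ℝ (fderiv ℝ (f ∘ ofComplex)) (z : ℂ) :=
    ((hf.contDiffAt z).fderiv_right (m := (⊤ : ℕ∞)) (by simp)).differentiableAt (by simp)
  have key : ∀ u v : ℂ, fderiv ℝ ((fun z : ℍ => fderiv ℝ (f ∘ ofComplex) (z : ℂ) u) ∘ ofComplex)
      (z : ℂ) v = fderiv ℝ (fderiv ℝ (f ∘ ofComplex)) (z : ℂ) v u := fun u v => by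
    have h : ((fun z : ℍ => fderiv ℝ (f ∘ ofComplex) (z : ℂ) u) ∘ ofComplex) =ᶠ[nhds (z : ℂ)]
        fun w => fderiv ℝ (f ∘ ofComplex) w u := by
      filter_upwards [im_pos_mem_nhds z] with w hw
      simp only [Function.comp_apply, coe_ofComplex_of_mem hw]
    rw [h.fderiv_eq, fderiv_clm_apply hd (by fun_prop)]
    simp
  exact (key 1 Complex.I).trans ((hsymm Complex.I 1).trans (key Complex.I 1).symm)

end Rules

/-! ### Raising and lowering operators and the weighted Laplacian. -/

/-- The Maass raising operator `E_k^+ = (z - z̄) ∂/∂z + k/2`. -/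
def raise (k : ℤ) (f : ℍ → ℂ) (z : ℍ) : ℂ :=
  Complex.I * imC z * dx f z + imC z * dy f z + (k : ℂ) / 2 * f z

theorem lower_apply (k : ℤ) (f : ℍ → ℂ) (z : ℍ) :
    lower k f z = Complex.I * imC z * dx f z - imC z * dy f z + (k : ℂ) / 2 * f z := by
  have h : (z : ℂ) - conj (z : ℂ) = 2 * Complex.I * imC z := by
    rw [Complex.sub_conj]; simp [imC]; ring
  rw [lower, h, dzbar]
  linear_combination (imC z * dy f z) * Complex.I_sq

section Operators

variable {f g : ℍ → ℂ}

theorem SmoothOnUpperHalfPlane.lower (hf : SmoothOnUpperHalfPlane f) (k : ℤ) :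
    SmoothOnUpperHalfPlane (lower k f) := by
  have h : EtaMaass.lower k f = fun z => Complex.I * (imC z * EtaMaass.dx f z) +
      (-1) * (imC z * EtaMaass.dy f z) + (k : ℂ) / 2 * f z := by
    funext z; rw [lower_apply]; ring
  rw [h]
  exact (((smooth_imC.mul hf.dx).const_mul _).add ((smooth_imC.mul hf.dy).const_mul _)).add
    (hf.const_mul _)

theorem SmoothOnUpperHalfPlane.lowerIter (hf : SmoothOnUpperHalfPlane f) (k : ℤ) (m : ℕ) :
    SmoothOnUpperHalfPlane (lowerIter k m f) := by
  induction m with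
  | zero => exact hf
  | succ m ih => exact ih.lower _

theorem dx_lower (hf : SmoothOnUpperHalfPlane f) (k : ℤ) (z : ℍ) :
    dx (lower k f) z = Complex.I * imC z * dx (dx f) z - imC z * dx (dy f) z +
      (k : ℂ) / 2 * dx f z := by
  have h : lower k f = fun z => Complex.I * (imC z * dx f z) +
      (-1) * (imC z * dy f z) + (k : ℂ) / 2 * f z := by
    funext z; rw [lower_apply]; ring
  have h1 := smooth_imC.mul hf.dx
  have h2 := smooth_imC.mul hf.dy
  rw [h, dx_add ((h1.const_mul _).add (h2.const_mul _)) (hf.const_mul _),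
    dx_add (h1.const_mul _) (h2.const_mul _), dx_const_mul h1, dx_const_mul h2, dx_const_mul hf,
    dx_mul smooth_imC hf.dx, dx_mul smooth_imC hf.dy, dx_imC]
  ring

theorem dy_lower (hf : SmoothOnUpperHalfPlane f) (k : ℤ) (z : ℍ) :
    dy (lower k f) z = Complex.I * imC z * dx (dy f) z - imC z * dy (dy f) z +
      (k : ℂ) / 2 * dy f z + Complex.I * dx f z - dy f z := by
  have h : lower k f = fun z => Complex.I * (imC z * dx f z) +
      (-1) * (imC z * dy f z) + (k : ℂ) / 2 * f z := by
    funext z; rw [lower_apply]; ring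
  have h1 := smooth_imC.mul hf.dx
  have h2 := smooth_imC.mul hf.dy
  rw [h, dy_add ((h1.const_mul _).add (h2.const_mul _)) (hf.const_mul _),
    dy_add (h1.const_mul _) (h2.const_mul _), dy_const_mul h1, dy_const_mul h2, dy_const_mul hf,
    dy_mul smooth_imC hf.dx, dy_mul smooth_imC hf.dy, dy_imC, dy_dx hf]
  ring

theorem dx_raise (hf : SmoothOnUpperHalfPlane f) (k : ℤ) (z : ℍ) :
    dx (raise k f) z = Complex.I * imC z * dx (dx f) z + imC z * dx (dy f) z +
      (k : ℂ) / 2 * dx f z := by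
  have h : raise k f = fun z => Complex.I * (imC z * dx f z) +
      (imC z * dy f z) + (k : ℂ) / 2 * f z := by
    funext z; rw [raise]; ring
  have h1 := smooth_imC.mul hf.dx
  have h2 := smooth_imC.mul hf.dy
  rw [h, dx_add ((h1.const_mul _).add h2) (hf.const_mul _),
    dx_add (h1.const_mul _) h2, dx_const_mul h1, dx_const_mul hf,
    dx_mul smooth_imC hf.dx, dx_mul smooth_imC hf.dy, dx_imC]
  ring

theorem dy_raise (hf : SmoothOnUpperHalfPlane f) (k : ℤ) (z : ℍ) :
    dy (raise k f) z = Complex.I * imC z * dx (dy f) z + imC z * dy (dy f) z +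
      (k : ℂ) / 2 * dy f z + Complex.I * dx f z + dy f z := by
  have h : raise k f = fun z => Complex.I * (imC z * dx f z) +
      (imC z * dy f z) + (k : ℂ) / 2 * f z := by
    funext z; rw [raise]; ring
  have h1 := smooth_imC.mul hf.dx
  have h2 := smooth_imC.mul hf.dy
  rw [h, dy_add ((h1.const_mul _).add h2) (hf.const_mul _),
    dy_add (h1.const_mul _) h2, dy_const_mul h1, dy_const_mul hf,
    dy_mul smooth_imC hf.dx, dy_mul smooth_imC hf.dy, dy_imC, dy_dx hf]
  ring

/-- In the product of `i y ∂x + y ∂y + (k-2)/2` and `i y ∂x - y ∂y + k/2` the mixed second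
derivatives cancel. The first-order terms in `∂y` cancel too, because the two weights differ by two.
-/
theorem raise_lower (hf : SmoothOnUpperHalfPlane f) (k : ℤ) (z : ℍ) :
    raise (k - 2) (lower k f) z =
      -laplacian k f z + (k : ℂ) / 2 * ((k : ℂ) / 2 - 1) * f z := by
  rw [raise, dx_lower hf, dy_lower hf, lower_apply, laplacian]
  push_cast
  change _ = -(imC z ^ 2 * _ - Complex.I * k * imC z * _) + _
  linear_combination (imC z ^ 2 * dx (dx f) z) * Complex.I_sq

theorem lower_raise (hf : SmoothOnUpperHalfPlane f) (k : ℤ) (z : ℍ) :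
    lower k (raise (k - 2) f) z =
      -laplacian (k - 2) f z + (k : ℂ) / 2 * ((k : ℂ) / 2 - 1) * f z := by
  rw [lower_apply, dx_raise hf, dy_raise hf, raise, laplacian]
  push_cast
  change _ = -(imC z ^ 2 * _ - Complex.I * (k - 2) * imC z * _) + _
  linear_combination (imC z ^ 2 * dx (dx f) z) * Complex.I_sq

theorem lower_const_mul (hf : SmoothOnUpperHalfPlane f) (k : ℤ) (c : ℂ) :
    lower k (fun z => c * f z) = fun z => c * lower k f z := by
  funext z
  rw [lower_apply, lower_apply, dx_const_mul hf, dy_const_mul hf]; ring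

theorem lowerIter_const_mul (hf : SmoothOnUpperHalfPlane f) (k : ℤ) (c : ℂ) (m : ℕ) :
    lowerIter k m (fun z => c * f z) = fun z => c * lowerIter k m f z := by
  induction m with
  | zero => rfl
  | succ m ih => rw [lowerIter, ih, lower_const_mul (hf.lowerIter k m)]; rfl

/-- The lowering operator maps eigenfunctions of weight `k` to eigenfunctions of weight `k - 2`. -/
theorem laplacian_lower (hf : SmoothOnUpperHalfPlane f) (k : ℤ) (c : ℂ)
    (h : ∀ z, laplacian k f z + c * f z = 0) (z : ℍ) :
    laplacian (k - 2) (lower k f) z + c * lower k f z = 0 := by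
  have h1 : raise (k - 2) (lower k f) = fun z => (c + (k : ℂ) / 2 * ((k : ℂ) / 2 - 1)) * f z := by
    funext w
    rw [raise_lower hf]
    linear_combination -h w
  -- The triple product lower-raise-lower is read in two ways: the inner raise-lower pair is a
  -- scalar because `f` is an eigenfunction, and the outer lower-raise pair is the Laplacian of
  -- weight `k - 2` up to the same constant.
  have h2 := lower_raise (hf.lower k) k z
  rw [h1, lower_const_mul hf] at h2
  linear_combination h2

theorem laplacian_lowerIter (hf : SmoothOnUpperHalfPlane f) (k : ℤ) (c : ℂ)
    (h : ∀ z, laplacian k f z + c * f z = 0) (m : ℕ) (z : ℍ) :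
    laplacian (k - 2 * m) (lowerIter k m f) z + c * lowerIter k m f z = 0 := by
  induction m generalizing z with
  | zero => simpa [lowerIter] using h z
  | succ m ih =>
    have := laplacian_lower (hf.lowerIter k m) (k - 2 * m) c ih z
    have e : k - 2 * ((m + 1 : ℕ) : ℤ) = k - 2 * m - 2 := by push_cast; ring
    rw [e]
    exact this

theorem raise_lower_of_eigen (hf : SmoothOnUpperHalfPlane f) (k : ℤ) (c : ℂ)
    (h : ∀ z, laplacian k f z + c * f z = 0) :
    raise (k - 2) (lower k f) = fun z => (c + (k : ℂ) / 2 * ((k : ℂ) / 2 - 1)) * f z := by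
  funext w
  rw [raise_lower hf]
  linear_combination -h w

end Operators

/-! ### Automorphy of the lowered function. -/

/-- The antilinear coefficient of a real linear endomorphism of `ℂ`. -/
def antilinearPart (L : ℂ →L[ℝ] ℂ) : ℂ := (L 1 + Complex.I * L Complex.I) / 2

theorem dzbar_eq (f : ℍ → ℂ) (z : ℍ) :
    dzbar f z = antilinearPart (fderiv ℝ (f ∘ ofComplex) (z : ℂ)) := rfl

/-- Writing `L u = p u + q ū`, precomposition with multiplication by `a` turns `q` into `q ā`. This
is the chain rule for `∂/∂z̄` along a holomorphic inner map. -/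
theorem antilinearPart_comp_mul (L : ℂ →L[ℝ] ℂ) (a : ℂ) :
    (L a + Complex.I * L (Complex.I * a)) / 2 = antilinearPart L * conj a := by
  have h : ∀ u : ℂ, L u = u.re * L 1 + u.im * L Complex.I := fun u => by
    have hu : u = u.re • (1 : ℂ) + u.im • Complex.I := by simp [Complex.re_add_im]
    conv_lhs => rw [hu, map_add, map_smul, map_smul]
    simp
  rw [antilinearPart, h a, h (Complex.I * a)]
  have hc : conj a = a.re - Complex.I * a.im := by
    apply Complex.ext <;> simp
  rw [hc]
  simp
  linear_combination (a.im * L Complex.I / 2) * Complex.I_sq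

/-- The unitary automorphy factor `(c z + d) / |c z + d|`, on all of `ℂ`. -/
def unitFactor (g : SL(2, ℤ)) (w : ℂ) : ℂ := denom g w / ‖denom g w‖

theorem autFactor_eq (k : ℤ) (g : SL(2, ℤ)) (z : ℍ) : autFactor k g z = unitFactor g z ^ k := by
  have hn : (‖denom g z‖ : ℂ) ≠ 0 := by simp
  have h : unitFactor g z = Complex.exp (Complex.arg (denom g z) * Complex.I) := by
    rw [unitFactor, div_eq_iff hn, mul_comm, Complex.norm_mul_exp_arg_mul_I]
  rw [h, ← Complex.exp_int_mul, autFactor]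
  congr 1; ring

theorem unitFactor_ne_zero (g : SL(2, ℤ)) (z : ℍ) : unitFactor g z ≠ 0 := by
  have hn := denom_ne_zero (g : GL (Fin 2) ℝ) z
  exact div_ne_zero hn (by simp)

/-- With `N = c z + d` and `j = N / |N|`, the relation `j² N̄ = N` determines the derivative of `j`
without differentiating the norm. -/
theorem unitFactor_sq_mul_conj (g : SL(2, ℤ)) (w : ℂ) :
    unitFactor g w * unitFactor g w * conj (denom g w) = denom g w := by
  by_cases hn : denom g w = 0
  · simp [unitFactor, hn]
  have hn' : (‖denom g w‖ : ℂ) ≠ 0 := by simpa using hn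
  rw [unitFactor]
  field_simp
  rw [Complex.mul_conj, Complex.normSq_eq_norm_sq]
  push_cast; ring

theorem denom_eq (g : SL(2, ℤ)) (w : ℂ) : denom g w = (g 1 0 : ℂ) * w + (g 1 1 : ℂ) := by
  simp [denom]

theorem hasFDerivAt_denom (g : SL(2, ℤ)) (w : ℂ) :
    HasFDerivAt (fun w : ℂ => denom g w)
      ((g 1 0 : ℂ) • ContinuousLinearMap.id ℝ ℂ) w := by
  simp only [denom_eq]
  exact ((hasFDerivAt_id (𝕜 := ℝ) w).const_mul (g 1 0 : ℂ)).add_const _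

theorem hasFDerivAt_conj_denom (g : SL(2, ℤ)) (w : ℂ) :
    HasFDerivAt (fun w : ℂ => conj (denom g w))
      ((Complex.conjCLE : ℂ →L[ℝ] ℂ) ∘L ((g 1 0 : ℂ) • ContinuousLinearMap.id ℝ ℂ)) w :=
  (Complex.conjCLE : ℂ →L[ℝ] ℂ).hasFDerivAt.comp w (hasFDerivAt_denom g w)

theorem differentiableAt_unitFactor (g : SL(2, ℤ)) (z : ℍ) :
    DifferentiableAt ℝ (unitFactor g) (z : ℂ) := by
  have hn := denom_ne_zero (g : GL (Fin 2) ℝ) z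
  have hd := (hasFDerivAt_denom g z).differentiableAt
  have h2 : DifferentiableAt ℝ (fun w : ℂ => (‖denom g w‖ : ℂ)) (z : ℂ) :=
    Complex.ofRealCLM.differentiableAt.comp _ (hd.norm ℝ hn)
  have h3 : unitFactor g = fun w : ℂ => denom g w * (‖denom g w‖ : ℂ)⁻¹ := by
    funext w; rw [unitFactor, div_eq_mul_inv]
  rw [h3]
  exact hd.mul (h2.inv (by simp))

/-- Apply `∂/∂z̄` to `j² N̄ = N`: the right side is holomorphic and contributes nothing, so `2 j
(∂j/∂z̄) N̄ + j² c = 0`. -/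
theorem antilinearPart_fderiv_unitFactor (g : SL(2, ℤ)) (z : ℍ) :
    2 * conj (denom g z) * antilinearPart (fderiv ℝ (unitFactor g) (z : ℂ)) =
      -(g 1 0 : ℂ) * unitFactor g z := by
  have hj := (differentiableAt_unitFactor g z).hasFDerivAt
  have h1 := (hj.mul hj).mul (hasFDerivAt_conj_denom g z)
  have h2 : (unitFactor g * unitFactor g * fun w : ℂ => conj (denom g w)) =
      fun w => denom g w := by
    funext w; exact unitFactor_sq_mul_conj g w
  rw [h2] at h1
  have h3 := h1.unique (hasFDerivAt_denom g z)
  have e1 := congrArg (fun L : ℂ →L[ℝ] ℂ => L 1) h3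
  have e2 := congrArg (fun L : ℂ →L[ℝ] ℂ => L Complex.I) h3
  simp at e1 e2
  have hu := unitFactor_ne_zero g z
  refine mul_left_cancel₀ hu ?_
  rw [antilinearPart]
  linear_combination e1 / 2 + Complex.I * e2 / 2 + (unitFactor g z ^ 2 * (g 1 0 : ℂ) / 2 + (g 1 0 : ℂ) / 2 ) * Complex.I_sq

/-- Differentiate the transformation law in `z̄`. As `g z` is holomorphic with derivative `N⁻²`, the
left side gives `∂f/∂z̄` at `g z` times `N̄⁻²`. The derivative of `j ^ k` leaves a multiple of `k c
f`, which combines with the term `k/2 f` through `c (z - z̄) = N - N̄`. The factor `N̄ / N = j⁻²`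
that comes out is the drop in weight. -/
theorem lower_smul {f : ℍ → ℂ} (hf : SmoothOnUpperHalfPlane f) (g : SL(2, ℤ)) (k : ℤ) (w : ℂ)
    (h : ∀ z : ℍ, f (g • z) = w * unitFactor g z ^ k * f z) (z : ℍ) :
    lower k f (g • z) = w * unitFactor g z ^ (k - 2) * lower k f z := by
  have hN := denom_ne_zero (g : GL (Fin 2) ℝ) z
  have hu := unitFactor_ne_zero g z
  have hdet1 : ((g : GL (Fin 2) ℝ)).val.det = 1 :=
    (Matrix.SpecialLinearGroup.map (Int.castRingHom ℝ) g).2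
  have hdet : 0 < ((g : GL (Fin 2) ℝ)).val.det := by rw [hdet1]; exact one_pos
  have hG := (hasStrictDerivAt_smul hdet z).hasDerivAt.hasFDerivAt.restrictScalars ℝ
  have hA := (hf.differentiableAt (g • z)).hasFDerivAt
  have hB := (hf.differentiableAt z).hasFDerivAt
  have hj := (differentiableAt_unitFactor g z).hasFDerivAt
  have hjk := (hasDerivAt_zpow k (unitFactor g z) (Or.inl hu)).comp_hasFDerivAt (z : ℂ) hj
  have hR := (hjk.const_mul w).mul hB
  have hA' : HasFDerivAt (𝕜 := ℝ) (f ∘ ofComplex) (fderiv ℝ (f ∘ ofComplex) ((g • z : ℍ) : ℂ))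
      (((g : GL (Fin 2) ℝ) • ofComplex (z : ℂ) : ℍ) : ℂ) := by
    rw [ofComplex_apply]; exact hA
  have hL := (hA'.comp (z : ℂ) hG).congr_of_eventuallyEq
    (f₁ := fun v : ℂ => f ((g : GL (Fin 2) ℝ) • ofComplex v))
    (Filter.Eventually.of_forall fun v => by simp)
  have hE : (fun v : ℂ => f ((g : GL (Fin 2) ℝ) • ofComplex v)) =ᶠ[nhds (z : ℂ)]
      fun v => w * unitFactor g v ^ k * (f ∘ ofComplex) v := by
    filter_upwards [im_pos_mem_nhds z] with v hv
    have := h (ofComplex v)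
    rw [coe_ofComplex_of_mem hv] at this
    exact this
  have hU := hL.unique (hR.congr_of_eventuallyEq hE)
  have e1 := congrArg (fun L : ℂ →L[ℝ] ℂ => L 1) hU
  have e2 := congrArg (fun L : ℂ →L[ℝ] ℂ => L Complex.I) hU
  rw [hdet1] at e1 e2
  simp at e1 e2
  have hjq := antilinearPart_fderiv_unitFactor g z
  have hsq := unitFactor_sq_mul_conj g z
  have hq : dzbar f (g • z) * conj (denom g z ^ 2)⁻¹ = w * unitFactor g z ^ k * dzbar f z +
      f z * (w * (k * unitFactor g z ^ (k - 1) *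
        antilinearPart (fderiv ℝ (unitFactor g) (z : ℂ)))) := by
    rw [dzbar_eq, dzbar_eq, ← antilinearPart_comp_mul, antilinearPart, antilinearPart]
    change fderiv ℝ (f ∘ ofComplex) ((g • z : ℍ) : ℂ) _ = _ at e1 e2
    linear_combination e1 / 2 + Complex.I * e2 / 2
  have him : ((g • z : ℍ) : ℂ) - conj ((g • z : ℍ) : ℂ) =
      ((z : ℂ) - conj (z : ℂ)) / (denom g z * conj (denom g z)) := by
    rw [Complex.sub_conj, Complex.sub_conj, Complex.mul_conj]
    have h1 : ((g • z : ℍ) : ℂ).im = (z : ℂ).im / Complex.normSq (denom g z) :=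
      ModularGroup.im_smul_eq_div_normSq g z
    rw [h1]; push_cast; ring
  have hc : denom g z - conj (denom g z) = (g 1 0 : ℂ) * ((z : ℂ) - conj (z : ℂ)) := by
    rw [denom_eq]; simp; ring
  have hNc : conj (denom g z) ≠ 0 := by simp
  have hz1 : unitFactor g z ^ (k - 1) = unitFactor g z ^ k / unitFactor g z := zpow_sub_one₀ hu k
  have hz2 : unitFactor g z ^ (k - 2) =
      unitFactor g z ^ k * (conj (denom g z) / denom g z) := by
    rw [zpow_sub₀ hu, div_eq_mul_inv]
    congr 1
    rw [inv_eq_iff_eq_inv, inv_div, eq_div_iff hNc, zpow_two]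
    exact hsq
  have hjq' : antilinearPart (fderiv ℝ (unitFactor g) (z : ℂ)) =
      -(g 1 0 : ℂ) * unitFactor g z / (2 * conj (denom g z)) := by
    rw [eq_div_iff (by simp)]
    linear_combination hjq
  have hq' : dzbar f (g • z) = conj (denom g z) ^ 2 * (w * unitFactor g z ^ k * (dzbar f z -
      k * f z * (g 1 0 : ℂ) / (2 * conj (denom g z)))) := by
    rw [hjq', hz1, map_inv₀, map_pow, ← div_eq_mul_inv, div_eq_iff (pow_ne_zero 2 hNc)] at hq
    rw [hq]
    field_simp
    ring
  rw [lower, lower, him, h, hz2, hq']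
  generalize denom g z = N at *
  generalize unitFactor g z ^ k = P at *
  have hN' : N = conj N + (g 1 0 : ℂ) * ((z : ℂ) - conj (z : ℂ)) := by linear_combination hc
  field_simp
  linear_combination (k * w * P * f z) * hc

/-! ### Reflection in the imaginary axis and the conjugate multiplier. -/

/-- The conjugate of a modular matrix by the reflection `z ↦ -z̄`. -/
def mirrorConj (g : SL(2, ℤ)) : SL(2, ℤ) :=
  ⟨!![g 0 0, -g 0 1; -g 1 0, g 1 1], by
    have := g.det_coe
    rw [Matrix.det_fin_two] at this
    rw [Matrix.det_fin_two_of]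
    linarith⟩

theorem mirrorConj_mirrorConj (g : SL(2, ℤ)) : mirrorConj (mirrorConj g) = g := by
  ext i j; fin_cases i <;> fin_cases j <;> simp [mirrorConj]

theorem coe_mirror (z : ℍ) : (mirror z : ℂ) = -conj (z : ℂ) := rfl

theorem mirror_mirror (z : ℍ) : mirror (mirror z) = z := by
  ext; simp [coe_mirror]

theorem mirror_eq_J_smul (z : ℍ) : mirror z = J • z := by
  ext1; rw [coe_J_smul, coe_mirror]

theorem denom_mirrorConj (g : SL(2, ℤ)) (z : ℍ) :
    denom (mirrorConj g) (mirror z) = conj (denom g z) := by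
  rw [denom_eq, denom_eq, coe_mirror]; simp [mirrorConj]

theorem mirror_smul (g : SL(2, ℤ)) (z : ℍ) : mirror (g • z) = mirrorConj g • mirror z := by
  ext1
  rw [coe_mirror, coe_specialLinearGroup_apply, coe_specialLinearGroup_apply, coe_mirror]
  simp [mirrorConj]
  ring

theorem unitFactor_mirrorConj (g : SL(2, ℤ)) (z : ℍ) :
    unitFactor (mirrorConj g) (mirror z) = (unitFactor g z)⁻¹ := by
  have h := unitFactor_sq_mul_conj g z
  have hN := denom_ne_zero (g : GL (Fin 2) ℝ) z
  rw [unitFactor, denom_mirrorConj, unitFactor, inv_div, RCLike.norm_conj,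
    div_eq_div_iff (by simp) hN, mul_comm, Complex.mul_conj, Complex.normSq_eq_norm_sq]
  push_cast; ring

/-- The product for `η` in powers of `q` has real coefficients, and `q` at `-z̄` is the conjugate of
`q` at `z`. -/
theorem eta_mirror (z : ℍ) : ModularForm.eta (mirror z : ℂ) = conj (ModularForm.eta (z : ℂ)) := by
  have hq : ∀ h : ℝ, Function.Periodic.qParam h (-conj (z : ℂ)) =
      conj (Function.Periodic.qParam h z) := fun h => by
    rw [Function.Periodic.qParam, Function.Periodic.qParam, ← Complex.exp_conj]
    congr 1; simp [Complex.conj_ofNat]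
  rw [coe_mirror, ModularForm.eta, ModularForm.eta, map_mul, hq]
  congr 1
  have hm : Multipliable fun n : ℕ => 1 - ModularForm.eta_q n (z : ℂ) :=
    ModularForm.multipliable_one_sub_pow (mod_cast norm_qParam_lt_one 1 z)
  rw [hm.map_tprod (starRingEnd ℂ) Complex.continuous_conj]
  refine tprod_congr fun n => ?_
  rw [ModularForm.eta_q, hq, map_sub, map_one, map_pow]

theorem mirror_I : mirror UpperHalfPlane.I = UpperHalfPlane.I := by
  ext1; simp [coe_mirror]

/-- The exponent `2k` clears the square root, so conjugation raises no question of branches. -/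
theorem etaSystem_eq (k : ℕ) (g : SL(2, ℤ)) :
    etaSystem k g = ModularForm.eta ↑(g • UpperHalfPlane.I) ^ (2 * k) /
      (denom g UpperHalfPlane.I ^ k * ModularForm.eta ↑UpperHalfPlane.I ^ (2 * k)) := by
  rw [etaSystem, etaMult, div_pow, mul_pow]
  congr 2
  rw [← Complex.cpow_nat_mul, ← Complex.cpow_natCast]
  congr 1; push_cast; ring

/-- The quotient defining the multiplier is read at `i`, which the mirror fixes; each of its factors
is conjugated when `g` is replaced by its mirror conjugate. -/
theorem etaSystem_mirrorConj (k : ℕ) (g : SL(2, ℤ)) :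
    etaSystem k (mirrorConj g) = etaSystemConj k g := by
  have h1 : mirrorConj g • UpperHalfPlane.I = mirror (g • UpperHalfPlane.I) := by
    rw [mirror_smul, mirror_I]
  have h2 : denom (mirrorConj g) UpperHalfPlane.I = conj (denom g UpperHalfPlane.I) := by
    rw [← denom_mirrorConj, mirror_I]
  have h3 : conj (ModularForm.eta (UpperHalfPlane.I : ℂ)) = ModularForm.eta UpperHalfPlane.I := by
    rw [← eta_mirror, mirror_I]
  rw [etaSystemConj, etaSystem_eq, etaSystem_eq, h1, h2, eta_mirror]
  rw [map_div₀, map_mul, map_pow, map_pow, map_pow, h3]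

theorem etaSystemConj_mirrorConj (k : ℕ) (g : SL(2, ℤ)) :
    etaSystemConj k (mirrorConj g) = etaSystem k g := by
  rw [← etaSystem_mirrorConj, mirrorConj_mirrorConj]

/-- The discriminant `η²⁴` is modular of weight 12 with trivial multiplier, so `etaMult g` is a 24th
root of unity. -/
theorem norm_etaMult (g : SL(2, ℤ)) : ‖etaMult g‖ = 1 := by
  have h1 := discriminant_smul g UpperHalfPlane.I
  have hne : ModularForm.eta ↑UpperHalfPlane.I ≠ 0 := ModularForm.eta_ne_zero UpperHalfPlane.I.2
  have h : etaMult g ^ 24 = 1 := by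
    rw [etaMult, div_pow, mul_pow, h1, ← Complex.cpow_nat_mul, ← Complex.cpow_natCast]
    have hd := denom_ne_zero (g : GL (Fin 2) ℝ) UpperHalfPlane.I
    norm_num
    exact ⟨hd, hne⟩
  have := congrArg norm h
  rw [norm_pow, norm_one] at this
  exact (pow_eq_one_iff_of_nonneg (norm_nonneg _) (by norm_num)).mp this

theorem norm_etaSystem (k : ℕ) (g : SL(2, ℤ)) : ‖etaSystem k g‖ = 1 := by
  rw [etaSystem, norm_pow, norm_etaMult, one_pow]

theorem norm_etaSystemConj (k : ℕ) (g : SL(2, ℤ)) : ‖etaSystemConj k g‖ = 1 := by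
  rw [etaSystemConj, RCLike.norm_conj, norm_etaSystem]

/-- The slash equation in multiplicative form. -/
theorem slash_eq_iff (k : ℤ) (g : SL(2, ℤ)) (f : ℍ → ℂ) (w : ℂ) (z : ℍ) :
    slash k g f z = w * f z ↔ f (g • z) = w * unitFactor g z ^ k * f z := by
  rw [slash, autFactor_eq, inv_mul_eq_iff_eq_mul₀ (zpow_ne_zero _ (unitFactor_ne_zero g z))]
  rw [mul_left_comm, mul_assoc]

theorem lowerIter_smul {f : ℍ → ℂ} (hf : SmoothOnUpperHalfPlane f) (g : SL(2, ℤ)) (k : ℤ) (w : ℂ)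
    (h : ∀ z : ℍ, f (g • z) = w * unitFactor g z ^ k * f z) (m : ℕ) (z : ℍ) :
    lowerIter k m f (g • z) = w * unitFactor g z ^ (k - 2 * m) * lowerIter k m f z := by
  induction m generalizing z with
  | zero => simpa [lowerIter] using h z
  | succ m ih =>
    have := lower_smul (hf.lowerIter k m) g (k - 2 * m) w ih z
    have e : k - 2 * ((m + 1 : ℕ) : ℤ) = k - 2 * m - 2 := by push_cast; ring
    rw [e]
    exact this

section Reflect

/-- The reflection `w ↦ -w̄` as a real linear map. -/
def mirrorCLM : ℂ →L[ℝ] ℂ := -(Complex.conjCLE : ℂ →L[ℝ] ℂ)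

@[simp]
theorem mirrorCLM_apply (w : ℂ) : mirrorCLM w = -conj w := rfl

variable {f : ℍ → ℂ}

theorem reflect_comp_ofComplex_eqOn (f : ℍ → ℂ) :
    Set.EqOn (reflect f ∘ ofComplex) ((f ∘ ofComplex) ∘ mirrorCLM)
      {z : ℂ | 0 < z.im} := fun w hw => by
  simp only [Function.comp_apply, reflect]
  congr 1
  ext1
  rw [coe_mirror, coe_ofComplex_of_mem hw, coe_ofComplex_of_mem (by simpa using hw)]
  simp

theorem SmoothOnUpperHalfPlane.reflect (hf : SmoothOnUpperHalfPlane f) :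
    SmoothOnUpperHalfPlane (reflect f) := by
  refine ContDiffOn.congr ?_ (reflect_comp_ofComplex_eqOn f)
  exact ContDiffOn.comp hf mirrorCLM.contDiff.contDiffOn
    fun w hw => by simpa using hw

theorem fderiv_reflect (hf : SmoothOnUpperHalfPlane f) (z : ℍ) (v : ℂ) :
    fderiv ℝ (reflect f ∘ ofComplex) (z : ℂ) v =
      fderiv ℝ (f ∘ ofComplex) (mirror z : ℂ) (-conj v) := by
  have h : reflect f ∘ ofComplex =ᶠ[nhds (z : ℂ)]
      ((f ∘ ofComplex) ∘ mirrorCLM) := by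
    filter_upwards [im_pos_mem_nhds z] with w hw using reflect_comp_ofComplex_eqOn f hw
  have hd : DifferentiableAt ℝ (f ∘ ofComplex) (mirrorCLM (z : ℂ)) :=
    hf.differentiableAt (mirror z)
  rw [h.fderiv_eq, fderiv_comp _ hd (ContinuousLinearMap.differentiableAt _),
    ContinuousLinearMap.fderiv]
  simp [coe_mirror]

theorem dx_reflect (hf : SmoothOnUpperHalfPlane f) (z : ℍ) :
    dx (reflect f) z = -reflect (dx f) z := by
  rw [dx, fderiv_reflect hf]; simp [reflect, dx]

theorem dy_reflect (hf : SmoothOnUpperHalfPlane f) (z : ℍ) :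
    dy (reflect f) z = reflect (dy f) z := by
  rw [dy, fderiv_reflect hf]; simp [reflect, dy]

theorem imC_mirror (z : ℍ) : imC (mirror z) = imC z := by
  have : (mirror z).im = z.im := by
    change (-conj (z : ℂ)).im = _; simp
  rw [imC, this, imC]

/-- Reflection changes the sign of `∂x` only, so `i y ∂x - y ∂y + k/2` becomes the negative of `i y
∂x + y ∂y - k/2`. -/
theorem lower_reflect (hf : SmoothOnUpperHalfPlane f) (k : ℤ) :
    lower k (reflect f) = reflect (fun z => -raise (-k) f z) := by
  funext z
  rw [lower_apply, dx_reflect hf, dy_reflect hf]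
  simp only [reflect, raise, imC_mirror]
  push_cast; ring

theorem laplacian_reflect (hf : SmoothOnUpperHalfPlane f) (k : ℤ) (z : ℍ) :
    laplacian k (reflect f) z = reflect (laplacian (-k) f) z := by
  have h1 : dx (reflect f) = fun z => (-1) * reflect (dx f) z := by
    funext w; rw [dx_reflect hf]; ring
  have h2 : dy (reflect f) = reflect (dy f) := by funext w; exact dy_reflect hf w
  have him : ((mirror z).im : ℂ) = z.im := imC_mirror z
  rw [laplacian, h1, dx_const_mul hf.dx.reflect, dx_reflect hf.dx, h2, dy_reflect hf.dy]
  simp only [reflect, laplacian, him]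
  push_cast; ring

theorem reflect_smul {k : ℤ} (w : SL(2, ℤ) → ℂ)
    (h : ∀ g, ∀ z : ℍ, f (g • z) = w g * unitFactor g z ^ k * f z) (g : SL(2, ℤ)) (z : ℍ) :
    reflect f (g • z) = w (mirrorConj g) * unitFactor g z ^ (-k) * reflect f z := by
  rw [reflect, mirror_smul, h, unitFactor_mirrorConj, inv_zpow, ← zpow_neg, reflect]

end Reflect

/-! ### Contiguous relations for Kummer and Whittaker functions. -/

section Kummer

/-- The regularized Kummer function `₁F₁(a; b; z) / Γ(b)`. -/
def kummer (a b z : ℂ) : ℂ := Complex.regularizedHGFun {a} {b} z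

/-- The coefficients of the regularized Kummer function. -/
def kummerCoeff (a b : ℂ) (n : ℕ) : ℂ :=
  (ascPochhammer ℂ n).eval a / (n.factorial * Complex.Gamma (b + n))

theorem regularizedHGFunSeries_apply (a b z : ℂ) (n : ℕ) :
    Complex.regularizedHGFunSeries {a} {b} n (fun _ => z) = kummerCoeff a b n * z ^ n := by
  rw [Complex.regularizedHGFunSeries, FormalMultilinearSeries.ofScalars_apply_eq]
  simp [Complex.regularizedHGFunCoeff, kummerCoeff]

theorem hasFPowerSeriesOnBall_kummer (a b : ℂ) :
    HasFPowerSeriesOnBall (kummer a b) (Complex.regularizedHGFunSeries {a} {b}) 0 ⊤ := by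
  have h : (Complex.regularizedHGFunSeries {a} {b}).radius = ⊤ :=
    Complex.radius_regularizedHGFunSeries_eq_top (by simp)
  have := (Complex.regularizedHGFunSeries {a} {b}).hasFPowerSeriesOnBall (by rw [h]; simp)
  rwa [h] at this

theorem hasSum_kummer (a b z : ℂ) :
    HasSum (fun n : ℕ => kummerCoeff a b n * z ^ n) (kummer a b z) := by
  have := (hasFPowerSeriesOnBall_kummer a b).hasSum (y := z) (by simp)
  rw [zero_add] at this
  exact this.congr_fun fun n => (regularizedHGFunSeries_apply a b z n).symm

theorem differentiableAt_kummer (a b z : ℂ) : DifferentiableAt ℂ (kummer a b) z :=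
  ((hasFPowerSeriesOnBall_kummer a b).analyticAt_of_mem (by simp)).differentiableAt

theorem hasSum_mul_deriv_kummer (a b z : ℂ) :
    HasSum (fun n : ℕ => n * kummerCoeff a b n * z ^ n) (z * deriv (kummer a b) z) := by
  have h1 := (hasFPowerSeriesOnBall_kummer a b).fderiv.hasSum (y := z) (by simp)
  have h2 := (ContinuousLinearMap.apply ℂ ℂ z).hasSum h1
  have h3 : HasSum (fun n : ℕ => ((n + 1 : ℕ) : ℂ) * kummerCoeff a b (n + 1) * z ^ (n + 1))
      (z * deriv (kummer a b) z) := by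
    have h5 : fderiv ℂ (kummer a b) (0 + z) z = z * deriv (kummer a b) z := by
      rw [zero_add, fderiv_eq_deriv_mul, mul_comm]
    rw [← h5]
    refine HasSum.congr_fun h2 fun n => ?_
    rw [ContinuousLinearMap.apply_apply, FormalMultilinearSeries.derivSeries_apply_diag,
      regularizedHGFunSeries_apply]
    simp; ring
  have h4 := (hasSum_nat_add_iff (f := fun n : ℕ => n * kummerCoeff a b n * z ^ n) 1).mp h3
  simpa using h4

theorem ascPochhammer_eval_mul_add (a : ℂ) (n : ℕ) :
    (ascPochhammer ℂ n).eval a * (a + n) = a * (ascPochhammer ℂ n).eval (a + 1) := by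
  have h1 : (ascPochhammer ℂ (n + 1)).eval a = (ascPochhammer ℂ n).eval a * (a + n) := by
    rw [ascPochhammer_succ_right]; simp
  have h2 : (ascPochhammer ℂ (n + 1)).eval a = a * (ascPochhammer ℂ n).eval (a + 1) := by
    rw [ascPochhammer_succ_left]; simp
  rw [← h1, h2]

/-- Coefficientwise this is `(a + n) (a)ₙ = a (a + 1)ₙ`: the operator `z d/dz + a` raises the
parameter `a`. -/
theorem mul_deriv_kummer (a b z : ℂ) :
    z * deriv (kummer a b) z = a * kummer (a + 1) b z - a * kummer a b z := by
  have h := ((hasSum_kummer (a + 1) b z).mul_left a).sub ((hasSum_kummer a b z).mul_left a)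
  refine (hasSum_mul_deriv_kummer a b z).unique (h.congr_fun fun n => ?_)
  have hp := ascPochhammer_eval_mul_add a n
  have : a * kummerCoeff (a + 1) b n = (a + n) * kummerCoeff a b n := by
    rw [kummerCoeff, kummerCoeff]
    linear_combination -hp / (n.factorial * Complex.Gamma (b + n))
  linear_combination -this * z ^ n

/-- The companion relation, lowering `a`. Comparing coefficients one degree apart needs `Γ(b + n +
1) = (b + n) Γ(b + n)`, whence the condition on `b`. -/
theorem mul_deriv_kummer' (a b z : ℂ) (hb : ∀ n : ℕ, b + n ≠ 0) :
    z * deriv (kummer a b) z =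
      (b - a) * kummer (a - 1) b z - (b - a) * kummer a b z + z * kummer a b z := by
  have h := ((hasSum_mul_deriv_kummer a b z).add ((hasSum_kummer a b z).mul_left (b - a))).sub
    ((hasSum_kummer (a - 1) b z).mul_left (b - a))
  -- The degree zero terms of the two Kummer series cancel, both coefficients being `1/Γ(b)`; the
  -- remaining terms are matched with the series of `z * kummer a b z`.
  have h1 := (hasSum_nat_add_iff' 1).mpr h
  have h2 := (hasSum_kummer a b z).mul_left z
  have h3 := h1.unique (h2.congr_fun fun n => ?_)
  · simp [kummerCoeff] at h3
    linear_combination h3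
  · have hg : Complex.Gamma (b + n + 1) = (b + n) * Complex.Gamma (b + n) :=
      Complex.Gamma_add_one _ (hb n)
    have h1 : (ascPochhammer ℂ (n + 1)).eval a = (ascPochhammer ℂ n).eval a * (a + n) := by
      rw [ascPochhammer_succ_right]; simp
    have h2 : (ascPochhammer ℂ (n + 1)).eval (a - 1) = (a - 1) * (ascPochhammer ℂ n).eval a := by
      rw [ascPochhammer_succ_left]; simp
    have hn : (n + 1 : ℂ) ≠ 0 := by exact_mod_cast n.succ_ne_zero
    have hfac : (n.factorial : ℂ) ≠ 0 := by exact_mod_cast n.factorial_ne_zero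
    have key : ((n + 1 : ℂ) + (b - a)) * kummerCoeff a b (n + 1) -
        (b - a) * kummerCoeff (a - 1) b (n + 1) = kummerCoeff a b n := by
      have e : b + ((n + 1 : ℕ) : ℂ) = b + n + 1 := by push_cast; ring
      rw [kummerCoeff, kummerCoeff, kummerCoeff, e, hg, h1, h2, Nat.factorial_succ]
      push_cast
      -- The zero case is excluded by `hb` in fact, but division by zero makes both sides vanish
      -- there, so no argument is needed.
      by_cases hG : Complex.Gamma (b + n) = 0
      · simp [hG]
      have := hb n
      field_simp
      ring
    push_cast
    linear_combination key * z ^ (n + 1)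

end Kummer

section Whittaker

theorem whittakerM_eq (κ μ : ℂ) (t : ℝ) : whittakerM κ μ t =
    Complex.exp (-(t : ℂ) / 2) * (t : ℂ) ^ (μ + 1 / 2) *
      (Complex.Gamma (1 + 2 * μ) * kummer (1 / 2 + μ - κ) (1 + 2 * μ) t) := rfl

theorem hasDerivAt_whittakerM (κ μ : ℂ) {t : ℝ} (ht : 0 < t) :
    HasDerivAt (whittakerM κ μ) (((-(t : ℂ) / 2 + (μ + 1 / 2)) * whittakerM κ μ t +
      Complex.exp (-(t : ℂ) / 2) * (t : ℂ) ^ (μ + 1 / 2) * (Complex.Gamma (1 + 2 * μ) *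
        (t * deriv (kummer (1 / 2 + μ - κ) (1 + 2 * μ)) t))) / t) t := by
  have ht' : (t : ℂ) ≠ 0 := by exact_mod_cast ht.ne'
  have h1 : HasDerivAt (fun s : ℂ => Complex.exp (-s / 2))
      (Complex.exp (-(t : ℂ) / 2) * (-1 / 2)) (t : ℂ) :=
    (((hasDerivAt_id (t : ℂ)).neg).div_const 2).cexp
  have h2 : HasDerivAt (fun s : ℂ => s ^ (μ + 1 / 2))
      ((μ + 1 / 2) * (t : ℂ) ^ (μ + 1 / 2 - 1)) (t : ℂ) := by
    simpa using (hasDerivAt_id (t : ℂ)).cpow_const (c := μ + 1 / 2)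
      (Complex.ofReal_mem_slitPlane.mpr ht)
  have h3 := (differentiableAt_kummer (1 / 2 + μ - κ) (1 + 2 * μ) t).hasDerivAt.const_mul
    (Complex.Gamma (1 + 2 * μ))
  have h4 := ((h1.mul h2).mul h3).comp_ofReal
  refine HasDerivAt.congr_deriv (f := whittakerM κ μ) h4 ?_
  rw [whittakerM_eq, Complex.cpow_sub _ _ ht', Complex.cpow_one]
  simp only [Pi.mul_apply]
  field_simp

theorem differentiableAt_whittakerM (κ μ : ℂ) {t : ℝ} (ht : 0 < t) :
    DifferentiableAt ℝ (whittakerM κ μ) t := (hasDerivAt_whittakerM κ μ ht).differentiableAt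

/-- Lowering `κ` by one raises `a = 1/2 + μ - κ` by one; the elementary prefactor contributes `-t/2
+ μ + 1/2`. -/
theorem mul_deriv_whittakerM_down (κ μ : ℂ) {t : ℝ} (ht : 0 < t) :
    t * deriv (whittakerM κ μ) t = (κ - t / 2) * whittakerM κ μ t +
      (1 / 2 + μ - κ) * whittakerM (κ - 1) μ t := by
  have ht' : (t : ℂ) ≠ 0 := by exact_mod_cast ht.ne'
  rw [(hasDerivAt_whittakerM κ μ ht).deriv, mul_deriv_kummer, mul_div_cancel₀ _ ht',
    whittakerM_eq, whittakerM_eq]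
  have e : 1 / 2 + μ - (κ - 1) = 1 / 2 + μ - κ + 1 := by ring
  rw [e]; ring

/-- Here `a` goes down by one, `b - a = 1/2 + μ + κ`, and the extra summand `z * kummer` reverses
the sign of `t/2`. A nonreal `μ` keeps `1 + 2μ + n` away from zero. -/
theorem mul_deriv_whittakerM_up (κ μ : ℂ) {t : ℝ} (ht : 0 < t) (hμ : μ.im ≠ 0) :
    t * deriv (whittakerM κ μ) t = (t / 2 - κ) * whittakerM κ μ t +
      (1 / 2 + μ + κ) * whittakerM (κ + 1) μ t := by
  have ht' : (t : ℂ) ≠ 0 := by exact_mod_cast ht.ne'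
  have hb : ∀ n : ℕ, 1 + 2 * μ + n ≠ 0 := fun n h => by
    have := congrArg Complex.im h
    simp at this
    exact hμ this
  rw [(hasDerivAt_whittakerM κ μ ht).deriv, mul_deriv_kummer' _ _ _ hb, mul_div_cancel₀ _ ht',
    whittakerM_eq, whittakerM_eq]
  have e : 1 / 2 + μ - (κ + 1) = 1 / 2 + μ - κ - 1 := by ring
  rw [e]; ring

theorem hasDerivAt_whittakerW (κ μ : ℂ) {t : ℝ} (ht : 0 < t) :
    HasDerivAt (whittakerW κ μ)
      (Complex.Gamma (-(2 * μ)) / Complex.Gamma (1 / 2 - μ - κ) * deriv (whittakerM κ μ) t +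
        Complex.Gamma (2 * μ) / Complex.Gamma (1 / 2 + μ - κ) * deriv (whittakerM κ (-μ)) t) t :=
  ((differentiableAt_whittakerM κ μ ht).hasDerivAt.const_mul _).add
    ((differentiableAt_whittakerM κ (-μ) ht).hasDerivAt.const_mul _)

theorem Gamma_div_step (κ μ : ℂ) (h : 1 / 2 - μ - κ ≠ 0) (c : ℂ) :
    c / Complex.Gamma (1 / 2 - μ - κ) =
      (1 / 2 - μ - κ) * (c / Complex.Gamma (1 / 2 - μ - (κ - 1))) := by
  have e : 1 / 2 - μ - (κ - 1) = 1 / 2 - μ - κ + 1 := by ring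
  rw [e, Complex.Gamma_add_one _ h]
  generalize 1 / 2 - μ - κ = s at h ⊢
  rw [mul_div_assoc', mul_div_mul_left _ _ h]

/-- Passing to the connection coefficients for `κ - 1` costs a factor `1/2 ∓ μ - κ`, while the
relation for `whittakerM` supplies `1/2 ± μ - κ`. The product `(κ - 1/2)² - μ²` is even in `μ`,
hence common to both summands. -/
theorem mul_deriv_whittakerW_down (κ : ℝ) (μ : ℂ) {t : ℝ} (ht : 0 < t) (hμ : μ.im ≠ 0) :
    t * deriv (whittakerW κ μ) t = (κ - t / 2) * whittakerW κ μ t -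
      (μ ^ 2 - (κ - 1 / 2) ^ 2) * whittakerW (κ - 1) μ t := by
  have h1 : (1 / 2 - μ - κ : ℂ) ≠ 0 := fun h => by
    have := congrArg Complex.im h
    simp at this
    exact hμ this
  have h2 : (1 / 2 - -μ - κ : ℂ) ≠ 0 := fun h => by
    have := congrArg Complex.im h
    simp at this
    exact hμ this
  have g1 := Gamma_div_step κ μ h1 (Complex.Gamma (-(2 * μ)))
  have g2 := Gamma_div_step κ (-μ) h2 (Complex.Gamma (2 * μ))
  simp only [sub_neg_eq_add] at g2
  have d1 := mul_deriv_whittakerM_down κ μ ht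
  have d2 := mul_deriv_whittakerM_down κ (-μ) ht
  rw [(hasDerivAt_whittakerW κ μ ht).deriv, whittakerW, whittakerW]
  rw [mul_add, mul_left_comm, d1, mul_left_comm, d2]
  rw [g1, g2]
  ring

/-- Now the factor `1/2 ± μ + κ` from `whittakerM` is, up to sign, exactly the one absorbed by the
connection coefficients for `κ + 1`, so only `-1` remains. -/
theorem mul_deriv_whittakerW_up (κ : ℝ) (μ : ℂ) {t : ℝ} (ht : 0 < t) (hμ : μ.im ≠ 0) :
    t * deriv (whittakerW κ μ) t = (t / 2 - κ) * whittakerW κ μ t - whittakerW (κ + 1) μ t := by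
  have h1 : (1 / 2 - μ - (κ + 1) : ℂ) ≠ 0 := fun h => by
    have := congrArg Complex.im h
    simp at this
    exact hμ this
  have h2 : (1 / 2 - -μ - (κ + 1) : ℂ) ≠ 0 := fun h => by
    have := congrArg Complex.im h
    simp at this
    exact hμ this
  have g1 := Gamma_div_step (κ + 1) μ h1 (Complex.Gamma (-(2 * μ)))
  have g2 := Gamma_div_step (κ + 1) (-μ) h2 (Complex.Gamma (2 * μ))
  simp only [sub_neg_eq_add, add_sub_cancel_right] at g1 g2
  have d1 := mul_deriv_whittakerM_up κ μ ht hμ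
  have d2 := mul_deriv_whittakerM_up κ (-μ) ht (by simpa using hμ)
  rw [(hasDerivAt_whittakerW κ μ ht).deriv, whittakerW, whittakerW]
  rw [mul_add, mul_left_comm, d1, mul_left_comm, d2]
  rw [g1, g2]
  ring

end Whittaker

/-! ### Horizontal Fourier coefficients. -/

/-- The point `x + i y` of the upper half-plane, for `y > 0`. -/
def point (x y : ℝ) : ℍ := ofComplex (x + y * Complex.I)

theorem coe_point (x : ℝ) {y : ℝ} (hy : 0 < y) : (point x y : ℂ) = x + y * Complex.I :=
  coe_ofComplex_of_mem (by simpa using hy)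

theorem point_re_im (z : ℍ) : point z.re z.im = z := by
  ext1
  rw [coe_point _ z.im_pos]
  exact Complex.re_add_im _

theorem im_point (x : ℝ) {y : ℝ} (hy : 0 < y) : (point x y).im = y := by
  change (point x y : ℂ).im = y
  rw [coe_point x hy]; simp

theorem re_point (x : ℝ) {y : ℝ} (hy : 0 < y) : (point x y).re = x := by
  change (point x y : ℂ).re = x
  rw [coe_point x hy]; simp

theorem imC_point (x : ℝ) {y : ℝ} (hy : 0 < y) : imC (point x y) = y := by
  rw [imC, im_point x hy]

theorem point_add_one (x : ℝ) {y : ℝ} (hy : 0 < y) : point (x + 1) y = (1 : ℝ) +ᵥ point x y := by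
  ext1
  rw [coe_point _ hy, coe_vadd, coe_point _ hy]; push_cast; ring

theorem mirror_point (x : ℝ) {y : ℝ} (hy : 0 < y) : mirror (point x y) = point (-x) y := by
  ext1
  rw [coe_mirror, coe_point _ hy, coe_point _ hy]; simp [add_comm]

section Curves

variable {f : ℍ → ℂ}

theorem hasDerivAt_point_x (hf : SmoothOnUpperHalfPlane f) (x : ℝ) {y : ℝ} (hy : 0 < y) :
    HasDerivAt (fun x : ℝ => f (point x y)) (dx f (point x y)) x := by
  have h1 : HasDerivAt (fun x : ℝ => (x : ℂ) + y * Complex.I) 1 x :=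
    (hasDerivAt_id x).ofReal_comp.add_const _
  have h2 := (hf.differentiableAt (point x y)).hasFDerivAt
  rw [coe_point x hy] at h2
  have h3 := h2.comp_hasDerivAt x h1
  rw [← coe_point x hy] at h3
  exact h3

theorem hasDerivAt_point_y (hf : SmoothOnUpperHalfPlane f) (x : ℝ) {y : ℝ} (hy : 0 < y) :
    HasDerivAt (fun y : ℝ => f (point x y)) (dy f (point x y)) y := by
  have h1 : HasDerivAt (fun y : ℝ => (x : ℂ) + y * Complex.I) Complex.I y := by
    simpa using ((hasDerivAt_id y).ofReal_comp.mul_const Complex.I).const_add (x : ℂ)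
  have h2 := (hf.differentiableAt (point x y)).hasFDerivAt
  rw [coe_point x hy] at h2
  have h3 := h2.comp_hasDerivAt y h1
  rw [← coe_point x hy] at h3
  exact h3

theorem continuousOn_point (hf : Continuous f) :
    ContinuousOn (fun p : ℝ × ℝ => f (point p.1 p.2)) {p | 0 < p.2} := by
  refine hf.comp_continuousOn ?_
  rw [UpperHalfPlane.isOpenEmbedding_coe.isInducing.continuousOn_iff]
  have : Continuous fun p : ℝ × ℝ => (p.1 : ℂ) + p.2 * Complex.I := by fun_prop
  exact this.continuousOn.congr fun p hp => coe_point _ hp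

theorem continuous_point_x (hf : Continuous f) {y : ℝ} (hy : 0 < y) :
    Continuous fun x : ℝ => f (point x y) :=
  (continuousOn_point hf).comp_continuous (f := fun x : ℝ => (x, y)) (by fun_prop) fun _ => hy

end Curves

section FourierCoefficients

/-- The exponential `e(β x)`. -/
def expChar (β x : ℝ) : ℂ := Complex.exp (2 * Real.pi * Complex.I * β * x)

theorem expChar_def (β x : ℝ) :
    expChar β x = Complex.exp (2 * Real.pi * Complex.I * β * x) := rfl

theorem continuous_expChar (β : ℝ) : Continuous (expChar β) := by
  unfold expChar; fun_prop

theorem norm_expChar (β x : ℝ) : ‖expChar β x‖ = 1 := by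
  have : expChar β x = Complex.exp ((2 * Real.pi * β * x : ℝ) * Complex.I) := by
    rw [expChar]; congr 1; push_cast; ring
  rw [this, Complex.norm_exp_ofReal_mul_I]

theorem expChar_add (β γ x : ℝ) : expChar (β + γ) x = expChar β x * expChar γ x := by
  rw [expChar, expChar, expChar, ← Complex.exp_add]; congr 1; push_cast; ring

theorem expChar_zero (x : ℝ) : expChar 0 x = 1 := by simp [expChar]

theorem expChar_zero_right (β : ℝ) : expChar β 0 = 1 := by simp [expChar]

theorem expChar_add_right (β x y : ℝ) : expChar β (x + y) = expChar β x * expChar β y := by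
  rw [expChar, expChar, expChar, ← Complex.exp_add]; congr 1; push_cast; ring

theorem expChar_int (n : ℤ) : expChar n 1 = 1 := by
  rw [expChar]
  exact Complex.exp_eq_one_iff.mpr ⟨n, by push_cast; ring⟩

theorem expChar_neg_mul (β x : ℝ) : expChar (-β) x * expChar β x = 1 := by
  rw [← expChar_add, neg_add_cancel, expChar_zero]

theorem expChar_neg_right (β x : ℝ) : expChar β (-x) = expChar (-β) x := by
  rw [expChar, expChar]; congr 1; push_cast; ring

theorem hasDerivAt_expChar (β x : ℝ) :
    HasDerivAt (expChar β) (2 * Real.pi * Complex.I * β * expChar β x) x := by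
  have h1 : HasDerivAt (fun x : ℝ => 2 * Real.pi * Complex.I * β * (x : ℂ))
      (2 * Real.pi * Complex.I * β) x := by
    simpa using (hasDerivAt_id x).ofReal_comp.const_mul (2 * Real.pi * Complex.I * β : ℂ)
  exact HasDerivAt.congr_deriv (f := expChar β) h1.cexp (mul_comm _ _)

/-- The `β`-th Fourier coefficient of `f` along the horizontal segment at height `y`. -/
def fourierIntegral (β : ℝ) (f : ℍ → ℂ) (y : ℝ) : ℂ :=
  ∫ x in (0 : ℝ)..1, f (point x y) * expChar (-β) x

variable {f : ℍ → ℂ}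

theorem continuous_fourier_integrand (hf : Continuous f) (β : ℝ) {y : ℝ} (hy : 0 < y) :
    Continuous fun x : ℝ => f (point x y) * expChar (-β) x :=
  (continuous_point_x hf hy).mul (continuous_expChar _)

/-- Integration by parts; the boundary terms cancel because `f` and the character of frequency `β`
have the same quasi-period factor. -/
theorem fourierIntegral_dx (hf : SmoothOnUpperHalfPlane f) (β : ℝ) {y : ℝ} (hy : 0 < y)
    (hper : f (point 1 y) = expChar β 1 * f (point 0 y)) :
    fourierIntegral β (dx f) y = 2 * Real.pi * Complex.I * β * fourierIntegral β f y := by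
  have hd : ∀ x : ℝ, HasDerivAt (fun x : ℝ => f (point x y) * expChar (-β) x)
      (dx f (point x y) * expChar (-β) x -
        2 * Real.pi * Complex.I * β * (f (point x y) * expChar (-β) x)) x := fun x => by
    refine ((hasDerivAt_point_x hf x hy).mul (hasDerivAt_expChar (-β) x)).congr_deriv ?_
    push_cast; ring
  have h1 := continuous_fourier_integrand hf.dx.continuous β hy
  have h2 := (continuous_fourier_integrand hf.continuous β hy).const_mul
    (2 * Real.pi * Complex.I * β)
  have h3 := intervalIntegral.integral_eq_sub_of_hasDerivAt (a := 0) (b := 1) (fun x _ => hd x)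
    ((h1.sub h2).intervalIntegrable _ _)
  rw [intervalIntegral.integral_sub (h1.intervalIntegrable _ _) (h2.intervalIntegrable _ _),
    intervalIntegral.integral_const_mul, hper, expChar_zero_right] at h3
  rw [fourierIntegral, fourierIntegral]
  linear_combination h3 + f (point 0 y) * expChar_neg_mul β 1

theorem hasDerivAt_fourierIntegral (hf : SmoothOnUpperHalfPlane f) (β : ℝ) {y : ℝ} (hy : 0 < y) :
    HasDerivAt (fourierIntegral β f) (fourierIntegral β (dy f) y) y := by
  have hcont := continuousOn_point hf.dy.continuous
  have hK : IsCompact (Set.Icc (0 : ℝ) 1 ×ˢ Set.Icc (y / 2) (2 * y)) :=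
    isCompact_Icc.prod isCompact_Icc
  obtain ⟨C, hC⟩ := hK.exists_bound_of_continuousOn
    (hcont.mono fun p hp => lt_of_lt_of_le (half_pos hy) hp.2.1)
  refine (intervalIntegral.hasDerivAt_integral_of_dominated_loc_of_deriv_le
    (F := fun y x => f (point x y) * expChar (-β) x)
    (F' := fun y x => dy f (point x y) * expChar (-β) x) (bound := fun _ => C)
    (s := Set.Ioo (y / 2) (2 * y)) (Ioo_mem_nhds (by linarith) (by linarith)) ?_ ?_ ?_ ?_ ?_ ?_).2
  · filter_upwards [lt_mem_nhds hy] with v hv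
    exact (continuous_fourier_integrand hf.continuous β hv).aestronglyMeasurable
  · exact (continuous_fourier_integrand hf.continuous β hy).intervalIntegrable _ _
  · exact (continuous_fourier_integrand hf.dy.continuous β hy).aestronglyMeasurable
  · refine Filter.Eventually.of_forall fun x hx v hv => ?_
    rw [Set.uIoc_of_le zero_le_one] at hx
    rw [norm_mul, norm_expChar, mul_one]
    exact hC (x, v) ⟨⟨hx.1.le, hx.2⟩, ⟨hv.1.le, hv.2.le⟩⟩
  · exact intervalIntegrable_const
  · refine Filter.Eventually.of_forall fun x _ v hv => ?_
    exact (hasDerivAt_point_y hf x (lt_trans (half_pos hy) hv.1)).mul_const _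

/-- On one frequency the lowering operator becomes an ordinary differential operator in `y`, of the
shape to which the Whittaker relations apply. -/
theorem fourierIntegral_lower (hf : SmoothOnUpperHalfPlane f) (m : ℤ) (β : ℝ) {y : ℝ} (hy : 0 < y)
    (hper : f (point 1 y) = expChar β 1 * f (point 0 y)) :
    fourierIntegral β (lower m f) y =
      (-(2 * Real.pi * β * y) + (m : ℂ) / 2) * fourierIntegral β f y -
        y * deriv (fourierIntegral β f) y := by
  rw [(hasDerivAt_fourierIntegral hf β hy).deriv]
  have hx := fourierIntegral_dx hf β hy hper
  have h1 := (continuous_fourier_integrand hf.dx.continuous β hy).intervalIntegrable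
    (μ := MeasureTheory.volume) 0 1
  have h2 := (continuous_fourier_integrand hf.dy.continuous β hy).intervalIntegrable
    (μ := MeasureTheory.volume) 0 1
  have h3 := (continuous_fourier_integrand hf.continuous β hy).intervalIntegrable
    (μ := MeasureTheory.volume) 0 1
  have h4 : fourierIntegral β (lower m f) y = Complex.I * y * fourierIntegral β (dx f) y -
      y * fourierIntegral β (dy f) y + (m : ℂ) / 2 * fourierIntegral β f y := by
    simp only [fourierIntegral]
    rw [← intervalIntegral.integral_const_mul, ← intervalIntegral.integral_const_mul,
      ← intervalIntegral.integral_const_mul, ← intervalIntegral.integral_sub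
        (h1.const_mul _) (h2.const_mul _), ← intervalIntegral.integral_add
        ((h1.const_mul _).sub (h2.const_mul _)) (h3.const_mul _)]
    refine intervalIntegral.integral_congr fun x _ => ?_
    simp only [lower_apply, imC_point _ hy]
    ring
  rw [h4, hx]
  linear_combination (2 * Real.pi * β * y * fourierIntegral β f y) * Complex.I_sq

theorem integral_expChar_int (m : ℤ) :
    ∫ x in (0 : ℝ)..1, expChar m x = if m = 0 then 1 else 0 := by
  split_ifs with h
  · simp [h, expChar_zero]
  · have hc : (2 * Real.pi * Complex.I * (m : ℝ) : ℂ) ≠ 0 := by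
      have := Real.pi_ne_zero
      simp [h, this]
    have h1 := intervalIntegral.integral_eq_sub_of_hasDerivAt (a := 0) (b := 1)
      (fun x _ => hasDerivAt_expChar m x)
      (((continuous_expChar m).const_mul _).intervalIntegrable _ _)
    rw [intervalIntegral.integral_const_mul, expChar_int, expChar_zero_right, sub_self] at h1
    exact (mul_eq_zero.mp h1).resolve_left hc

/-- The Fourier coefficients of a pointwise convergent expansion. -/
theorem fourierIntegral_eq_of_hasSum {α y : ℝ} {a : ℤ → ℂ}
    (h : ∀ x : ℝ, HasSum (fun n : ℤ => a n * expChar (n + α) x) (f (point x y))) (n : ℤ) :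
    fourierIntegral (n + α) f y = a n := by
  -- Convergence at `x = 0` is already absolute, and the characters have modulus one, so `‖a n‖`
  -- dominates the series for every `x` and termwise integration is allowed.
  have hs : Summable fun n => ‖a n‖ := by
    have := (h 0).summable.norm
    simpa [expChar_zero_right] using this
  have h1 := intervalIntegral.hasSum_integral_of_dominated_convergence (a := 0) (b := 1)
    (μ := MeasureTheory.volume)
    (F := fun m : ℤ => fun x : ℝ => a m * expChar (m + α) x * expChar (-(n + α)) x)
    (f := fun x => f (point x y) * expChar (-(n + α)) x) (fun m _ => ‖a m‖)
    (fun m => ((continuous_const.mul (continuous_expChar _)).mul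
      (continuous_expChar _)).aestronglyMeasurable)
    (fun m => Filter.Eventually.of_forall fun x _ => by simp [norm_expChar])
    (Filter.Eventually.of_forall fun _ _ => hs) intervalIntegrable_const
    (Filter.Eventually.of_forall fun x _ => (h x).mul_right _)
  have h2 : ∀ m : ℤ, ∫ x in (0 : ℝ)..1, a m * expChar (m + α) x * expChar (-(n + α)) x =
      if m = n then a m else 0 := fun m => by
    have e : ∀ x : ℝ, a m * expChar (m + α) x * expChar (-(n + α)) x =
        a m * expChar ((m - n : ℤ) : ℝ) x := fun x => by
      rw [mul_assoc, ← expChar_add]; congr 2; push_cast; ring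
    simp only [e, intervalIntegral.integral_const_mul, integral_expChar_int, sub_eq_zero]
    split_ifs <;> simp
  simp only [h2] at h1
  have h3 : HasSum (fun m : ℤ => if m = n then a m else 0) (a n) := hasSum_ite_eq n (a n) |>.congr_fun fun m => by
    split_ifs with hm
    · rw [hm]
    · rfl
  exact h1.unique h3

theorem norm_fourierIntegral_le {C y β : ℝ} (h : ∀ x ∈ Set.Icc (0 : ℝ) 1, ‖f (point x y)‖ ≤ C) :
    ‖fourierIntegral β f y‖ ≤ C := by
  have := intervalIntegral.norm_integral_le_of_norm_le_const (a := 0) (b := 1) (C := C)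
    (f := fun x => f (point x y) * expChar (-β) x) fun x hx => by
      rw [Set.uIoc_of_le zero_le_one] at hx
      rw [norm_mul, norm_expChar, mul_one]
      exact h x ⟨hx.1.le, hx.2⟩
  rw [fourierIntegral]
  simpa using this

/-- Translation behaviour is inherited by `∂/∂x`. -/
theorem dx_point_add_one (hf : SmoothOnUpperHalfPlane f) {y : ℝ} (hy : 0 < y) (c : ℂ)
    (hper : ∀ x, f (point (x + 1) y) = c * f (point x y)) (x : ℝ) :
    dx f (point (x + 1) y) = c * dx f (point x y) := by
  have h1 : HasDerivAt (fun x : ℝ => f (point (x + 1) y)) (dx f (point (x + 1) y)) x :=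
    HasDerivAt.comp_add_const x 1 (hasDerivAt_point_x hf (x + 1) hy)
  have h2 := (hasDerivAt_point_x hf x hy).const_mul c
  exact h1.unique (h2.congr_of_eventuallyEq (Filter.Eventually.of_forall hper))

theorem dy_point_add_one (hf : SmoothOnUpperHalfPlane f) (c : ℂ)
    (hper : ∀ x y, 0 < y → f (point (x + 1) y) = c * f (point x y)) (x : ℝ) {y : ℝ} (hy : 0 < y) :
    dy f (point (x + 1) y) = c * dy f (point x y) := by
  have h2 := (hasDerivAt_point_y hf x hy).const_mul c
  refine (hasDerivAt_point_y hf (x + 1) hy).unique (h2.congr_of_eventuallyEq ?_)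
  filter_upwards [lt_mem_nhds hy] with v hv using hper x v hv

theorem lowerIter_point_add_one (hf : SmoothOnUpperHalfPlane f) (c : ℂ)
    (hper : ∀ x y, 0 < y → f (point (x + 1) y) = c * f (point x y)) (k : ℤ) (m : ℕ) (x y : ℝ)
    (hy : 0 < y) :
    lowerIter k m f (point (x + 1) y) = c * lowerIter k m f (point x y) := by
  induction m generalizing x y with
  | zero => exact hper x y hy
  | succ m ih =>
    have hs := hf.lowerIter k m
    rw [lowerIter, lower_apply, lower_apply, dx_point_add_one hs hy c (fun x => ih x y hy),
      dy_point_add_one hs c ih x hy, ih x y hy, imC_point _ hy, imC_point _ hy]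
    ring

/-- Two integrations by parts give decay of order `(n + α)⁻²`; at most one index, where `n + α = 0`,
escapes the bound. -/
theorem summable_fourierIntegral (hf : SmoothOnUpperHalfPlane f) {α y : ℝ} (hy : 0 < y)
    (hper : ∀ x, f (point (x + 1) y) = expChar α 1 * f (point x y)) :
    Summable fun n : ℤ => fourierIntegral (n + α) f y := by
  have hchar : ∀ n : ℤ, expChar (n + α) 1 = expChar α 1 := fun n => by
    rw [expChar_add, expChar_int, one_mul]
  have h1 : ∀ n : ℤ, fourierIntegral (n + α) (dx (dx f)) y =
      -(2 * Real.pi * ((n : ℝ) + α : ℝ)) ^ 2 * fourierIntegral (n + α) f y := fun n => by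
    rw [fourierIntegral_dx hf.dx _ hy, fourierIntegral_dx hf _ hy]
    · linear_combination ((2 * Real.pi * ((n : ℝ) + α : ℝ)) ^ 2 * fourierIntegral (n + α) f y) *
        Complex.I_sq
    · rw [hchar, ← hper, zero_add]
    · rw [hchar, ← dx_point_add_one hf hy _ hper, zero_add]
  obtain ⟨C, hC⟩ := (isCompact_Icc (a := (0 : ℝ)) (b := 1)).exists_bound_of_continuousOn
    (continuous_point_x hf.dx.dx.continuous hy).continuousOn
  have hs := ((Real.summable_one_div_int_add_rpow α 2).mpr one_lt_two).mul_left C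
  refine Summable.of_norm_bounded_eventually hs ?_
  have hfin : {n : ℤ | (n : ℝ) + α = 0}.Finite := by
    refine Set.Subsingleton.finite fun a ha b hb => ?_
    have ha' : (a : ℝ) + α = 0 := ha
    have hb' : (b : ℝ) + α = 0 := hb
    exact_mod_cast (by linarith : (a : ℝ) = b)
  filter_upwards [hfin.compl_mem_cofinite] with n hn
  have hn' : (n : ℝ) + α ≠ 0 := hn
  have h2 := norm_fourierIntegral_le (β := n + α) hC
  rw [h1, norm_mul, norm_neg, norm_pow, ← Complex.ofReal_ofNat, ← Complex.ofReal_mul,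
    ← Complex.ofReal_mul, Complex.norm_real, Real.norm_eq_abs, sq_abs] at h2
  rw [Real.rpow_two, sq_abs, mul_one_div, le_div_iff₀ (by positivity)]
  refine le_trans ?_ h2
  rw [mul_comm]
  refine mul_le_mul_of_nonneg_right ?_ (norm_nonneg _)
  rw [mul_pow]
  have hpi := Real.pi_gt_three
  exact le_mul_of_one_le_left (sq_nonneg _) (by nlinarith)

/-- A smooth quasi-periodic function is the sum of its Fourier series. -/
theorem hasSum_fourierIntegral (hf : SmoothOnUpperHalfPlane f) {α y : ℝ} (hy : 0 < y)
    (hper : ∀ x, f (point (x + 1) y) = expChar α 1 * f (point x y)) (x : ℝ) :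
    HasSum (fun n : ℤ => fourierIntegral (n + α) f y * expChar (n + α) x) (f (point x y)) := by
  -- Twisting by the character of frequency `-α` makes the function 1-periodic, so Fourier theory on
  -- the circle applies.
  let φ : ℝ → ℂ := fun x => f (point x y) * expChar (-α) x
  have hφ : Function.Periodic φ 1 := fun x => by
    simp only [φ]
    rw [hper, expChar_add_right]
    linear_combination (f (point x y) * expChar (-α) x) * expChar_neg_mul α 1
  have hφc : Continuous φ := continuous_fourier_integrand hf.continuous α hy
  let Φ : C(AddCircle (1 : ℝ), ℂ) := ⟨hφ.lift, continuous_coinduced_dom.mpr hφc⟩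
  have hcoef : ∀ n : ℤ, fourierCoeff Φ n = fourierIntegral (n + α) f y := fun n => by
    rw [fourierCoeff_eq_intervalIntegral _ _ 0, fourierIntegral]
    simp only [zero_add, div_one, one_smul]
    refine intervalIntegral.integral_congr fun x _ => ?_
    have : (Φ : AddCircle (1 : ℝ) → ℂ) (x : AddCircle (1 : ℝ)) = φ x := hφ.lift_coe x
    simp only [this, fourier_coe_apply, smul_eq_mul, φ]
    rw [neg_add, expChar_add, expChar_def (-(n : ℝ))]
    push_cast
    rw [div_one]
    ring
  have hs : Summable (fourierCoeff Φ) := by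
    simpa only [funext hcoef] using summable_fourierIntegral hf hy hper
  have h := (has_pointwise_sum_fourier_series_of_summable hs (x : AddCircle (1 : ℝ))).mul_right
    (expChar α x)
  have hv : (Φ : AddCircle (1 : ℝ) → ℂ) (x : AddCircle (1 : ℝ)) * expChar α x = f (point x y) := by
    have : (Φ : AddCircle (1 : ℝ) → ℂ) (x : AddCircle (1 : ℝ)) = φ x := hφ.lift_coe x
    rw [this]
    simp only [φ]
    rw [mul_assoc, expChar_neg_mul, mul_one]
  rw [hv] at h
  refine h.congr_fun fun n => ?_
  rw [hcoef, fourier_coe_apply, expChar_add, expChar_def (n : ℝ), smul_eq_mul]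
  push_cast
  rw [div_one]
  ring

end FourierCoefficients

/-! ### The constant `Λ` as a product over the lowering steps. -/

section Constants

/-- The eigenvalue of `E_{m-2}^+ ∘ E_m^-` for `m = k - 2 i`. -/
def shiftConst (k : ℕ) (R : ℝ) (i : ℕ) : ℝ := R ^ 2 + ((k : ℝ) / 2 - i - 1 / 2) ^ 2

theorem shiftConst_pos (k : ℕ) {R : ℝ} (hR : R ≠ 0) (i : ℕ) : 0 < shiftConst k R i := by
  unfold shiftConst; positivity

/-- The factors for `i` and `k - 1 - i` coincide, since `k/2 - i - 1/2` only changes sign; each pair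
yields a square. For odd `k` the middle factor `-R²` stays unpaired. The even case uses `(j - 1/2)²
= j(j - 1) + 1/4`. -/
theorem Lam_eq_prod (k : ℕ) (R : ℝ) : Lam k R = ∏ i ∈ Finset.range k, -shiftConst k R i := by
  have hIcc : ∀ (l : ℕ) (F : ℕ → ℝ), ∏ j ∈ Finset.Icc 1 l, F j = ∏ i ∈ Finset.range l, F (1 + i) :=
    fun l F => by
      have : Finset.Icc 1 l = Finset.Ico 1 (l + 1) := by ext; simp
      rw [this, Finset.prod_Ico_eq_prod_range, Nat.add_sub_cancel]
  rw [Lam]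
  split_ifs with h
  · obtain ⟨l, rfl⟩ := h
    have hl : (l + l) / 2 = l := by omega
    rw [hl, hIcc, Finset.prod_range_add,
      ← Finset.prod_range_reflect (fun i => -shiftConst (l + l) R i), ← Finset.prod_mul_distrib]
    refine Finset.prod_congr rfl fun i hi => ?_
    have hi' := Finset.mem_range.mp hi
    have e : ((l - 1 - i : ℕ) : ℝ) = l - 1 - i := by
      rw [Nat.cast_sub (by omega), Nat.cast_sub (by omega)]; simp
    simp only [shiftConst, e]
    push_cast; ring
  · obtain ⟨l, rfl⟩ := Nat.not_even_iff_odd.mp h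
    have hl : (2 * l + 1) / 2 = l := by omega
    have hr : 2 * l + 1 = l + (l + 1) := by ring
    have hs : ∏ i ∈ Finset.range (2 * l + 1), -shiftConst (2 * l + 1) R i =
        ∏ i ∈ Finset.range (l + (l + 1)), -shiftConst (2 * l + 1) R i := by rw [← hr]
    rw [hl, hIcc, hs, Finset.prod_range_add, Finset.prod_range_succ', ← mul_assoc,
      ← Finset.prod_range_reflect (fun i => -shiftConst (2 * l + 1) R i), ← Finset.prod_mul_distrib,
      mul_comm]
    congr 1
    · refine Finset.prod_congr rfl fun i hi => ?_
      have hi' := Finset.mem_range.mp hi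
      have e : ((l - 1 - i : ℕ) : ℝ) = l - 1 - i := by
        rw [Nat.cast_sub (by omega), Nat.cast_sub (by omega)]; simp
      simp only [shiftConst, e]
      push_cast; ring
    · simp only [shiftConst]
      push_cast; ring

end Constants

/-! ### The Fourier expansion of `Θ f`. -/

section Expansion

theorem fourierTerm_eq (k : ℕ) (R β : ℝ) (z : ℍ) : fourierTerm k R β z =
    (1 / (√|β| : ℝ) : ℂ) * whittakerW (((k : ℝ) / 2 * Real.sign β : ℝ) : ℂ) (Complex.I * R)
      (4 * Real.pi * |β| * z.im) * expChar β z.re := rfl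

variable {f : ℍ → ℂ}

theorem mul_deriv_of_eq_whittakerW {F : ℝ → ℂ} {A κ μ : ℂ} {b : ℝ} (hb : 0 < b)
    (hF : ∀ y, 0 < y → F y = A * whittakerW κ μ (b * y)) {y : ℝ} (hy : 0 < y) :
    y * deriv F y = A * ((b * y : ℝ) * deriv (whittakerW κ μ) (b * y)) := by
  have h1 := ((hasDerivAt_whittakerW κ μ (mul_pos hb hy)).differentiableAt).hasDerivAt
  have h2 : HasDerivAt (fun y : ℝ => b * y) b y := by simpa using (hasDerivAt_id y).const_mul b
  have h3 := (h1.scomp y h2).const_mul A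
  have h4 : F =ᶠ[nhds y] fun y => A * (whittakerW κ μ ∘ fun y : ℝ => b * y) y := by
    filter_upwards [lt_mem_nhds hy] with v hv using hF v hv
  rw [(h3.congr_of_eventuallyEq h4).deriv]
  simp; ring

/-- At weight `k - 2m` the Whittaker index is `κ = k/2 - m`, half the weight, so the terms
proportional to `whittakerW κ` cancel and only the one with `κ - 1` survives, with factor `μ² - (κ -
1/2)²` where `μ = iR`. -/
theorem fourierIntegral_lowerIter_pos (hf : SmoothOnUpperHalfPlane f) (k : ℕ) {R β : ℝ}
    (hR : R ≠ 0) (hβ : 0 < β) {A : ℂ}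
    (hper : ∀ x y, 0 < y → f (point (x + 1) y) = expChar β 1 * f (point x y))
    (h : ∀ y, 0 < y → fourierIntegral β f y =
      A * whittakerW ((k : ℝ) / 2 : ℝ) (Complex.I * R) (4 * Real.pi * β * y)) (m : ℕ) (y : ℝ)
    (hy : 0 < y) :
    fourierIntegral β (lowerIter k m f) y =
      (A * ((∏ i ∈ Finset.range m, -shiftConst k R i : ℝ) : ℂ)) *
        whittakerW ((k : ℝ) / 2 - m : ℝ) (Complex.I * R) (4 * Real.pi * β * y) := by
  have hb : 0 < 4 * Real.pi * β := by have := Real.pi_pos; positivity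
  induction m generalizing y with
  | zero => simpa [lowerIter] using h y hy
  | succ m ih =>
    have hp := lowerIter_point_add_one hf _ hper k m 0 y hy
    rw [zero_add] at hp
    rw [lowerIter, fourierIntegral_lower (hf.lowerIter k m) _ β hy hp,
      mul_deriv_of_eq_whittakerW hb ih hy,
      mul_deriv_whittakerW_down _ _ (mul_pos hb hy) (by simpa using hR), ih y hy]
    have e : (((k : ℝ) / 2 - m : ℝ) : ℂ) - 1 = (((k : ℝ) / 2 - (m + 1 : ℕ) : ℝ) : ℂ) := by
      push_cast; ring
    rw [e, Finset.prod_range_succ]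
    have hs : ((-shiftConst k R m : ℝ) : ℂ) =
        (Complex.I * R) ^ 2 - ((((k : ℝ) / 2 - m : ℝ) : ℂ) - 1 / 2) ^ 2 := by
      rw [mul_pow, Complex.I_sq, shiftConst]; push_cast; ring
    rw [Complex.ofReal_mul (∏ i ∈ Finset.range m, -shiftConst k R i), hs]
    push_cast
    ring

/-- For negative frequency `κ` is minus half the weight; the upward relation then leaves exactly the
function with `κ + 1`, with no constant. -/
theorem fourierIntegral_lowerIter_neg (hf : SmoothOnUpperHalfPlane f) (k : ℕ) {R β : ℝ}
    (hR : R ≠ 0) (hβ : β < 0) {A : ℂ}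
    (hper : ∀ x y, 0 < y → f (point (x + 1) y) = expChar β 1 * f (point x y))
    (h : ∀ y, 0 < y → fourierIntegral β f y =
      A * whittakerW (-((k : ℝ) / 2) : ℝ) (Complex.I * R) (4 * Real.pi * -β * y)) (m : ℕ) (y : ℝ)
    (hy : 0 < y) :
    fourierIntegral β (lowerIter k m f) y =
      A * whittakerW (-((k : ℝ) / 2) + m : ℝ) (Complex.I * R) (4 * Real.pi * -β * y) := by
  have hb : 0 < 4 * Real.pi * -β := by have := Real.pi_pos; have := neg_pos.mpr hβ; positivity
  induction m generalizing y with
  | zero => simpa [lowerIter] using h y hy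
  | succ m ih =>
    have hp := lowerIter_point_add_one hf _ hper k m 0 y hy
    rw [zero_add] at hp
    rw [lowerIter, fourierIntegral_lower (hf.lowerIter k m) _ β hy hp,
      mul_deriv_of_eq_whittakerW hb ih hy,
      mul_deriv_whittakerW_up _ _ (mul_pos hb hy) (by simpa using hR), ih y hy]
    have e : ((-((k : ℝ) / 2) + m : ℝ) : ℂ) + 1 = ((-((k : ℝ) / 2) + (m + 1 : ℕ) : ℝ) : ℂ) := by
      push_cast; ring
    rw [e]
    push_cast
    ring

theorem hasSum_Theta (hf : SmoothOnUpperHalfPlane f) {k : ℕ} (hk1 : 1 ≤ k) (hk11 : k ≤ 11) {R : ℝ}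
    (hR : R ≠ 0) (c : ℤ → ℂ)
    (h : ∀ z : ℍ, HasSum (fun n : ℤ => c n * expansionTerm n k R z) (f z)) (z : ℍ) :
    HasSum (fun n : ℤ => (if 1 ≤ n then (1 : ℂ) else (Lam k R : ℂ)) * c (-n) *
      expansionTermConj n k R z) (Theta k f z) := by
  set α : ℝ := (k : ℝ) / 12 with hα
  have hα0 : 0 < α := by
    have : (1 : ℝ) ≤ k := by exact_mod_cast hk1
    rw [hα]; linarith
  have hα1 : α < 1 := by
    have : (k : ℝ) ≤ 11 := by exact_mod_cast hk11
    rw [hα]; linarith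
  let W : ℤ → ℝ → ℂ := fun n y => c n * ((1 / (√|(n : ℝ) + α| : ℝ) : ℂ) *
    whittakerW (((k : ℝ) / 2 * Real.sign (n + α) : ℝ) : ℂ) (Complex.I * R)
      (4 * Real.pi * |(n : ℝ) + α| * y))
  have hW : ∀ x y, 0 < y → HasSum (fun n : ℤ => W n y * expChar (n + α) x) (f (point x y)) :=
    fun x y hy => by
      refine (h (point x y)).congr_fun fun n => ?_
      simp only [W]
      rw [expansionTerm, fourierTerm_eq, im_point x hy, re_point x hy]
      ring
  have hchar : ∀ n : ℤ, expChar (n + α) 1 = expChar α 1 := fun n => by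
    rw [expChar_add, expChar_int, one_mul]
  -- Quasi-periodicity is read off from the expansion: all its frequencies are congruent to `α`
  -- modulo 1.
  have hper : ∀ x y, 0 < y → f (point (x + 1) y) = expChar α 1 * f (point x y) := fun x y hy => by
    refine (hW (x + 1) y hy).unique (((hW x y hy).mul_left (expChar α 1)).congr_fun fun n => ?_)
    rw [expChar_add_right, hchar]; ring
  have hcoef : ∀ (n : ℤ) (y : ℝ), 0 < y → fourierIntegral (n + α) f y = W n y := fun n y hy =>
    fourierIntegral_eq_of_hasSum (fun x => hW x y hy) n
  have hT : Theta k f z = lowerIter k k f (point (-z.re) z.im) := by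
    rw [Theta, reflect, ← mirror_point _ z.im_pos, point_re_im]
  rw [hT]
  have hfin := hasSum_fourierIntegral (hf.lowerIter k k) z.im_pos
    (fun x => lowerIter_point_add_one hf _ hper k k x z.im z.im_pos) (-z.re)
  -- The reflection evaluates the series at `-x`, so frequency `-n + k/12` of the lowered function
  -- becomes `n - k/12`; hence the coefficient `c (-n)`.
  rw [← (Equiv.neg ℤ).hasSum_iff] at hfin
  refine hfin.congr_fun fun n => ?_
  simp only [Function.comp_apply, Equiv.neg_apply]
  have hper' : ∀ x y, 0 < y → f (point (x + 1) y) =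
      expChar (((-n : ℤ) : ℝ) + α) 1 * f (point x y) := by
    rw [hchar]; exact hper
  have hβ : ((-n : ℤ) : ℝ) + α = -((n : ℝ) - (k : ℝ) / 12) := by rw [hα]; push_cast; ring
  rw [expChar_neg_right, expansionTermConj, fourierTerm_eq]
  -- Since `0 < α < 1`, the frequency `-n + α` is negative for `n ≥ 1` and positive for `n ≤ 0`;
  -- this is where the range of `k` enters.
  split_ifs with hn
  · have hn' : (1 : ℝ) ≤ n := by exact_mod_cast hn
    have hlt : ((-n : ℤ) : ℝ) + α < 0 := by push_cast; linarith
    have hpos : 0 < (n : ℝ) - (k : ℝ) / 12 := by rw [← hα]; linarith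
    rw [fourierIntegral_lowerIter_neg hf k hR hlt hper'
      (A := c (-n) * (1 / (√|((-n : ℤ) : ℝ) + α| : ℝ) : ℂ)) (fun y hy => by
        rw [hcoef _ _ hy]
        simp only [W]
        rw [Real.sign_of_neg hlt, abs_of_neg hlt, mul_neg_one]; ring_nf) k z.im z.im_pos]
    rw [hβ, neg_neg, abs_neg, Real.sign_of_pos hpos, abs_of_pos hpos]
    have e : -((k : ℝ) / 2) + k = (k : ℝ) / 2 * 1 := by ring
    rw [e]; ring
  · have hn' : (n : ℝ) ≤ 0 := by exact_mod_cast (by omega : n ≤ 0)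
    have hgt : 0 < ((-n : ℤ) : ℝ) + α := by push_cast; linarith
    have hneg : (n : ℝ) - (k : ℝ) / 12 < 0 := by rw [← hα]; linarith
    rw [fourierIntegral_lowerIter_pos hf k hR hgt hper'
      (A := c (-n) * (1 / (√|((-n : ℤ) : ℝ) + α| : ℝ) : ℂ)) (fun y hy => by
        rw [hcoef _ _ hy]
        simp only [W]
        rw [Real.sign_of_pos hgt, abs_of_pos hgt, mul_one]; ring_nf) k z.im z.im_pos]
    rw [hβ, neg_neg, abs_neg, Real.sign_of_neg hneg, abs_of_neg hneg, Lam_eq_prod]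
    have e : (k : ℝ) / 2 - k = (k : ℝ) / 2 * -1 := by ring
    rw [e]; ring

end Expansion

/-! ### The square of `Θ`. -/

section ThetaSquare

variable {f : ℍ → ℂ}

theorem SmoothOnUpperHalfPlane.Theta (hf : SmoothOnUpperHalfPlane f) (k : ℕ) :
    SmoothOnUpperHalfPlane (Theta k f) := (hf.lowerIter k k).reflect

/-- Iterated lowering of the reflection, undone step by step. -/
theorem lowerIter_reflect_lowerIter (hf : SmoothOnUpperHalfPlane f) (k : ℕ) (R : ℝ)
    (h : ∀ z, laplacian k f z + (1 / 4 + (R : ℂ) ^ 2) * f z = 0) (m : ℕ) (hm : m ≤ k) :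
    lowerIter k m (Theta k f) = fun z =>
      ((∏ i ∈ Finset.range m, -shiftConst k R (k - 1 - i) : ℝ) : ℂ) *
        reflect (lowerIter k (k - m) f) z := by
  induction m with
  | zero => funext z; simp [lowerIter, Theta]
  | succ m ih =>
    have hs := hf.lowerIter k (k - m)
    obtain ⟨j, hj⟩ : ∃ j, k - m = j + 1 := ⟨k - m - 1, by omega⟩
    have hj' : k - (m + 1) = j := by omega
    have hj2 : k - 1 - m = j := by omega
    have hjs := hf.lowerIter k j
    rw [lowerIter, ih (by omega), lower_const_mul hs.reflect, lower_reflect hs, hj, hj',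
      Finset.prod_range_succ, hj2]
    funext z
    -- With `j = k - m - 1`, the reflected operator is minus raising from weight `(k - 2j) - 2`,
    -- precisely the partner of the last lowering operator still present, so the pair collapses to a
    -- scalar.
    have hw : -((k : ℤ) - 2 * (m : ℤ)) = (k - 2 * (j : ℤ)) - 2 := by omega
    have hr := raise_lower_of_eigen hjs (k - 2 * j) _ (laplacian_lowerIter hf k _ h j)
    simp only [reflect]
    rw [hw, lowerIter, hr, Complex.ofReal_mul]
    have e : ((-shiftConst k R j : ℝ) : ℂ) = -(1 / 4 + (R : ℂ) ^ 2 +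
        (((k : ℤ) - 2 * (j : ℤ) : ℤ) : ℂ) / 2 * ((((k : ℤ) - 2 * (j : ℤ) : ℤ) : ℂ) / 2 - 1)) := by
      rw [shiftConst]; push_cast; ring
    rw [e]
    ring

theorem Theta_Theta (hf : SmoothOnUpperHalfPlane f) (k : ℕ) (R : ℝ)
    (h : ∀ z, laplacian k f z + (1 / 4 + (R : ℂ) ^ 2) * f z = 0) :
    Theta k (Theta k f) = (Lam k R : ℂ) • f := by
  funext z
  rw [Theta, lowerIter_reflect_lowerIter hf k R h k le_rfl, Lam_eq_prod,
    Finset.prod_range_reflect (fun i => -shiftConst k R i)]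
  simp [reflect, mirror_mirror, lowerIter]

theorem Theta_const_mul (hf : SmoothOnUpperHalfPlane f) (k : ℕ) (c : ℂ) :
    Theta k (fun z => c * f z) = fun z => c * Theta k f z := by
  rw [Theta, lowerIter_const_mul hf]; rfl

theorem Lam_ne_zero (k : ℕ) {R : ℝ} (hR : R ≠ 0) : Lam k R ≠ 0 := by
  rw [Lam_eq_prod, Finset.prod_ne_zero_iff]
  exact fun i _ => neg_ne_zero.mpr (shiftConst_pos k hR i).ne'

end ThetaSquare

/-! ### Square integrability in coordinates near the cusp. -/

section Measure

open MeasureTheory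

/-- Integrability on the upper half-plane in terms of the coordinates `x` and `y`. -/
theorem integrableOn_upperHalfPlane_iff (g : ℍ → ℝ) {t : Set (ℝ × ℝ)} (ht : MeasurableSet t)
    (hpos : ∀ p ∈ t, 0 < p.2) :
    IntegrableOn g {z : ℍ | (z.re, z.im) ∈ t} ↔
      IntegrableOn (fun p : ℝ × ℝ => (1 / p.2) ^ 2 * g (point p.1 p.2)) t := by
  have hre : Measurable fun z : ℍ => (z.re, z.im) :=
    (UpperHalfPlane.continuous_re.prodMk UpperHalfPlane.continuous_im).measurable
  have hs : MeasurableSet {z : ℍ | (z.re, z.im) ∈ t} := hre ht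
  have hρ : Measurable fun z : ℍ => (1 / NNReal.mk z.im z.im_pos.le) ^ 2 := by
    refine Measurable.pow_const (Measurable.div measurable_const ?_) 2
    exact (UpperHalfPlane.continuous_im.measurable).subtype_mk
  let h : ℂ → ℝ := fun w => (1 / w.im) ^ 2 * g (ofComplex w)
  have e1 : IntegrableOn g {z : ℍ | (z.re, z.im) ∈ t} ↔
      IntegrableOn (h ∘ UpperHalfPlane.coe) {z : ℍ | (z.re, z.im) ∈ t}
        (volume.comap UpperHalfPlane.coe) := by
    rw [IntegrableOn, UpperHalfPlane.volume_def, restrict_withDensity hs,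
      integrable_withDensity_iff_integrable_smul hρ, IntegrableOn]
    refine integrable_congr (Filter.Eventually.of_forall fun z => ?_)
    simp only [h, Function.comp_apply, ofComplex_apply, NNReal.smul_def, smul_eq_mul]
    rfl
  have himg : UpperHalfPlane.coe ⁻¹' (Complex.measurableEquivRealProd ⁻¹' t) =
      {z : ℍ | (z.re, z.im) ∈ t} := rfl
  have hsub : Complex.measurableEquivRealProd ⁻¹' t ⊆ Set.range UpperHalfPlane.coe := fun w hw =>
    ⟨⟨w, hpos _ hw⟩, rfl⟩
  rw [e1, ← himg, ← UpperHalfPlane.measurableEmbedding_coe.integrableOn_iff_comap hsub]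
  have e2 : h = (fun p : ℝ × ℝ => (1 / p.2) ^ 2 * g (point p.1 p.2)) ∘
      Complex.measurableEquivRealProd := by
    funext w
    simp only [h, Function.comp_apply, Complex.measurableEquivRealProd_apply, point,
      Complex.re_add_im]
  rw [e2]
  exact Complex.volume_preserving_equiv_real_prod.integrableOn_comp_preimage
    (MeasurableEquiv.measurableEmbedding _)

/-- The half strip `|x| ≤ 1/2`, `y ≥ c`. -/
def halfStrip (c : ℝ) : Set (ℝ × ℝ) := Set.Icc (-(1 / 2)) (1 / 2) ×ˢ Set.Ici c

theorem measurableSet_halfStrip (c : ℝ) : MeasurableSet (halfStrip c) :=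
  measurableSet_Icc.prod measurableSet_Ici

/-- The strip `y ≥ 1` lies inside the fundamental domain. Its straight sides permit the divergence
theorem on rectangles. -/
theorem integrableOn_halfStrip_of_fd {g : ℍ → ℝ} (h : IntegrableOn g ModularGroup.fd) :
    IntegrableOn (fun p : ℝ × ℝ => (1 / p.2) ^ 2 * g (point p.1 p.2)) (halfStrip 1) := by
  rw [← integrableOn_upperHalfPlane_iff g (measurableSet_halfStrip 1)
    fun p hp => lt_of_lt_of_le one_pos hp.2]
  refine h.mono_set fun z hz => ⟨?_, ?_⟩
  · have : 1 ≤ z.im := hz.2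
    rw [Complex.normSq_apply]
    change 1 ≤ z.re * z.re + z.im * z.im
    nlinarith [mul_self_nonneg z.re]
  · exact abs_le.mpr hz.1

/-- Below height 2 the fundamental domain lies in a compact rectangle with `y ≥ 1/2`, where
continuity suffices; only the cusp needs an estimate. -/
theorem integrableOn_fd_of_halfStrip {g : ℍ → ℝ} (hg : Continuous g)
    (h : IntegrableOn (fun p : ℝ × ℝ => (1 / p.2) ^ 2 * g (point p.1 p.2)) (halfStrip 2)) :
    IntegrableOn g ModularGroup.fd := by
  rw [← integrableOn_upperHalfPlane_iff g (measurableSet_halfStrip 2)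
    fun p hp => lt_of_lt_of_le two_pos hp.2] at h
  let K : Set ℍ := (fun p : ℝ × ℝ => point p.1 p.2) ''
    (Set.Icc (-(1 / 2)) (1 / 2) ×ˢ Set.Icc (1 / 2) 2)
  have hcont : ContinuousOn (fun p : ℝ × ℝ => point p.1 p.2)
      (Set.Icc (-(1 / 2)) (1 / 2) ×ˢ Set.Icc (1 / 2) 2) := by
    rw [UpperHalfPlane.isOpenEmbedding_coe.isInducing.continuousOn_iff]
    have : Continuous fun p : ℝ × ℝ => (p.1 : ℂ) + p.2 * Complex.I := by fun_prop
    refine this.continuousOn.congr fun p hp => coe_point _ ?_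
    exact lt_of_lt_of_le one_half_pos hp.2.1
  have hK : IsCompact K := (isCompact_Icc.prod isCompact_Icc).image_of_continuousOn hcont
  have hgK : IntegrableOn g K := hg.continuousOn.integrableOn_compact hK
  refine (h.union hgK).mono_set fun z hz => ?_
  have hre := abs_le.mp hz.2
  have him : 1 / 2 ≤ z.im := by
    have := ModularGroup.three_le_four_mul_im_sq_of_mem_fd hz
    nlinarith [z.im_pos]
  by_cases h2 : 2 ≤ z.im
  · exact Or.inl ⟨hre, h2⟩
  · exact Or.inr ⟨(z.re, z.im), ⟨hre, him, (not_le.mp h2).le⟩, point_re_im z⟩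

/-- The map `z ↦ -z̄` preserves both the hyperbolic measure and the fundamental domain. -/
theorem integrableOn_fd_reflect {f : ℍ → ℂ}
    (h : IntegrableOn (fun z : ℍ => ‖f z‖ ^ 2) ModularGroup.fd) :
    IntegrableOn (fun z : ℍ => ‖reflect f z‖ ^ 2) ModularGroup.fd := by
  have hJ : MeasurePreserving (fun z : ℍ => J • z) := measurePreserving_smul J volume
  have hpre : (fun z : ℍ => J • z) ⁻¹' ModularGroup.fd = ModularGroup.fd := by
    ext z
    have hre : (mirror z).re = -z.re := by
      change (-conj (z : ℂ)).re = _; simp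
    simp only [Set.mem_preimage, ← mirror_eq_J_smul, ModularGroup.fd, Set.mem_ofPred_eq, hre,
      coe_mirror, Complex.normSq_neg, Complex.normSq_conj, abs_neg]
  have := (hJ.integrableOn_comp_preimage (measurableEmbedding_const_smul J)).mpr h
  rw [hpre] at this
  refine this.congr_fun_ae (Filter.Eventually.of_forall fun z => ?_)
  simp only [Function.comp_apply, reflect, mirror_eq_J_smul]

end Measure

/-! ### A Caccioppoli estimate for the lowering operator. -/

section Caccioppoli

open MeasureTheory

variable {f : ℍ → ℂ}

theorem hasFDerivAt_point (hf : SmoothOnUpperHalfPlane f) (p : ℝ × ℝ) (hp : 0 < p.2) :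
    HasFDerivAt (fun p : ℝ × ℝ => f (point p.1 p.2))
      ((fderiv ℝ (f ∘ ofComplex) (point p.1 p.2 : ℂ)).comp
        (Complex.equivRealProdCLM.symm : ℝ × ℝ →L[ℝ] ℂ)) p := by
  have h1 := (hf.differentiableAt (point p.1 p.2)).hasFDerivAt
  have h2 : (point p.1 p.2 : ℂ) = Complex.equivRealProdCLM.symm p := by
    rw [coe_point _ hp, Complex.equivRealProdCLM_symm_apply]
  have h3 : HasFDerivAt (f ∘ ofComplex) (fderiv ℝ (f ∘ ofComplex) (point p.1 p.2 : ℂ))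
      (Complex.equivRealProdCLM.symm p) := by rw [← h2]; exact h1
  refine (h3.comp p (Complex.equivRealProdCLM.symm : ℝ × ℝ →L[ℝ] ℂ).hasFDerivAt).congr_of_eventuallyEq
    (Filter.Eventually.of_forall fun q => ?_)
  simp [point, Complex.equivRealProdCLM_symm_apply]

theorem SmoothOnUpperHalfPlane.conj (hf : SmoothOnUpperHalfPlane f) :
    SmoothOnUpperHalfPlane fun z => conj (f z) :=
  (Complex.conjCLE : ℂ →L[ℝ] ℂ).contDiff.comp_contDiffOn hf

theorem fderiv_conj_apply (hf : SmoothOnUpperHalfPlane f) (z : ℍ) (v : ℂ) :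
    fderiv ℝ ((fun z => conj (f z)) ∘ ofComplex) (z : ℂ) v =
      conj (fderiv ℝ (f ∘ ofComplex) (z : ℂ) v) := by
  have h := (Complex.conjCLE : ℂ →L[ℝ] ℂ).hasFDerivAt.comp (z : ℂ)
    (hf.differentiableAt z).hasFDerivAt
  exact congrArg (fun L : ℂ →L[ℝ] ℂ => L v) h.fderiv

/-- A cutoff function in the variable `y`, supported on `[1, T]`. -/
def cutoff (T y : ℝ) : ℝ := (1 - 1 / y) * (1 - y / T)

/-- The derivative of `cutoff`. -/
def cutoffDeriv (T y : ℝ) : ℝ := 1 / y ^ 2 * (1 - y / T) - (1 - 1 / y) / T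

theorem hasDerivAt_cutoff (T : ℝ) {y : ℝ} (hy : 0 < y) :
    HasDerivAt (cutoff T) (cutoffDeriv T y) y := by
  have h1 : HasDerivAt (fun y : ℝ => 1 - 1 / y) (1 / y ^ 2) y := by
    have := (hasDerivAt_inv hy.ne').const_sub 1
    simpa [one_div] using this
  have h2 : HasDerivAt (fun y : ℝ => 1 - y / T) (-(1 / T)) y :=
    ((hasDerivAt_id y).div_const T).const_sub 1
  refine (h1.mul h2).congr_deriv ?_
  rw [cutoffDeriv]; ring

theorem cutoff_mem {T y : ℝ} (h1 : 1 ≤ y) (h2 : y ≤ T) : 0 ≤ cutoff T y ∧ cutoff T y ≤ 1 := by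
  have hy : 0 < y := by linarith
  have hT : 0 < T := by linarith
  have a1 : 1 / y ≤ 1 := by rw [div_le_one hy]; exact h1
  have a2 : y / T ≤ 1 := by rw [div_le_one hT]; exact h2
  have a3 : 0 < 1 / y := by positivity
  have a4 : 0 < y / T := by positivity
  exact ⟨mul_nonneg (by linarith) (by linarith), mul_le_one₀ (by linarith) (by linarith)
    (by linarith)⟩

/-- The bound on `y χ'` is uniform in `T`, which is what allows `T → ∞` against the measure `dx dy /
y²`. -/
theorem abs_mul_cutoffDeriv_le {T y : ℝ} (h1 : 1 ≤ y) (h2 : y ≤ T) :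
    |y * cutoffDeriv T y| ≤ 2 := by
  have hy : 0 < y := by linarith
  have hT : 0 < T := by linarith
  have a1 : 1 / y ≤ 1 := by rw [div_le_one hy]; exact h1
  have a2 : y / T ≤ 1 := by rw [div_le_one hT]; exact h2
  have a3 : 0 < 1 / y := by positivity
  have a4 : 0 < y / T := by positivity
  have e : y * cutoffDeriv T y = 1 / y * (1 - y / T) - y / T * (1 - 1 / y) := by
    rw [cutoffDeriv]; field_simp
  rw [e, abs_le]
  constructor <;> nlinarith [mul_pos a3 a4]

theorem quarter_le_cutoff {T y : ℝ} (h1 : 2 ≤ y) (h2 : 2 * y ≤ T) : 1 / 4 ≤ cutoff T y := by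
  have hy : 0 < y := by linarith
  have hT : 0 < T := by linarith
  have a1 : 1 / y ≤ 1 / 2 := one_div_le_one_div_of_le two_pos h1
  have a2 : y / T ≤ 1 / 2 := by rw [div_le_div_iff₀ hT two_pos]; linarith
  rw [cutoff]
  nlinarith

/-- The pointwise inequality behind the Caccioppoli estimate. -/
theorem caccioppoli_pointwise {a b w s : ℂ} {y χ χ' c k : ℝ} (hy : 0 < y) (hχ0 : 0 ≤ χ)
    (hχ1 : χ ≤ 1) (hχ' : |y * χ'| ≤ 2) (hc : 0 ≤ c)
    (hs : (y : ℂ) ^ 2 * s - Complex.I * k * y * a + c * w = 0) :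
    χ ^ 2 * ((1 / y) ^ 2 * ‖Complex.I * y * a - y * b + (k : ℂ) / 2 * w‖ ^ 2) ≤
      6 * (χ ^ 2 * (s * conj w + a * conj a + b * conj b) + 2 * χ * χ' * (b * conj w) : ℂ).re +
        (6 * (k ^ 2 / 2 + c + 8) + 3 * k ^ 2 / 4) * ((1 / y) ^ 2 * ‖w‖ ^ 2) := by
  have hyC : (y : ℂ) ≠ 0 := by exact_mod_cast hy.ne'
  set A := ‖a‖ with hA
  set B := ‖b‖ with hB
  set V := 1 / y * ‖w‖ with hV
  have hV0 : 0 ≤ V := by positivity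
  have hw : ‖w‖ = y * V := by rw [hV]; field_simp
  have hs' : s = Complex.I * k / y * a - c / y ^ 2 * w := by
    field_simp
    linear_combination hs
  have haa : a * conj a = ((A ^ 2 : ℝ) : ℂ) := by
    rw [Complex.mul_conj, Complex.normSq_eq_norm_sq]
  have hbb : b * conj b = ((B ^ 2 : ℝ) : ℂ) := by
    rw [Complex.mul_conj, Complex.normSq_eq_norm_sq]
  have hww : w * conj w = ((y ^ 2 * V ^ 2 : ℝ) : ℂ) := by
    rw [Complex.mul_conj, Complex.normSq_eq_norm_sq, hw]; push_cast; ring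
  have hD : (χ ^ 2 * (s * conj w + a * conj a + b * conj b) + 2 * χ * χ' * (b * conj w) : ℂ).re =
      χ ^ 2 * (A ^ 2 + B ^ 2) - c * χ ^ 2 * V ^ 2 +
        χ ^ 2 * k * (1 / y * (Complex.I * (a * conj w)).re) + 2 * χ * χ' * (b * conj w).re := by
    have e : (χ ^ 2 * (s * conj w + a * conj a + b * conj b) + 2 * χ * χ' * (b * conj w) : ℂ) =
        ((χ ^ 2 * (A ^ 2 + B ^ 2) - c * χ ^ 2 * V ^ 2 : ℝ) : ℂ) +
        ((χ ^ 2 * k * (1 / y) : ℝ) : ℂ) * (Complex.I * (a * conj w)) +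
        ((2 * χ * χ' : ℝ) : ℂ) * (b * conj w) := by
      rw [hs', haa, hbb]
      have : (s * conj w : ℂ) = Complex.I * k / y * (a * conj w) - c * ((V ^ 2 : ℝ) : ℂ) := by
        rw [hs', sub_mul, mul_assoc, mul_assoc (c / (y : ℂ) ^ 2), hww]
        push_cast
        field_simp
      rw [hs'] at this
      rw [this]
      push_cast; ring
    rw [e, Complex.add_re, Complex.add_re, Complex.re_ofReal_mul, Complex.re_ofReal_mul,
      Complex.ofReal_re]
    ring
  have h1 : |1 / y * (Complex.I * (a * conj w)).re| ≤ A * V := by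
    have := Complex.abs_re_le_norm (Complex.I * (a * conj w))
    rw [norm_mul, norm_mul, Complex.norm_I, one_mul, RCLike.norm_conj, ← hA] at this
    rw [abs_mul, abs_of_pos (by positivity : 0 < 1 / y)]
    calc 1 / y * |(Complex.I * (a * conj w)).re| ≤ 1 / y * (A * ‖w‖) := by gcongr
      _ = A * V := by rw [hV]; ring
  have h2 : |χ' * (b * conj w).re| ≤ 2 * B * V := by
    have := Complex.abs_re_le_norm (b * conj w)
    rw [norm_mul, RCLike.norm_conj, ← hB] at this
    rw [abs_mul]
    calc |χ'| * |(b * conj w).re| ≤ |χ'| * (B * ‖w‖) := by gcongr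
      _ = |y * χ'| * (B * V) := by rw [abs_mul, abs_of_pos hy, hw]; ring
      _ ≤ 2 * (B * V) := by gcongr
      _ = 2 * B * V := by ring
  have h3 : 1 / y * ‖Complex.I * y * a - y * b + (k : ℂ) / 2 * w‖ ≤ A + B + |k| / 2 * V := by
    have : ‖Complex.I * y * a - y * b + (k : ℂ) / 2 * w‖ ≤ y * A + y * B + |k| / 2 * (y * V) := by
      refine (norm_add_le _ _).trans (add_le_add ((norm_sub_le _ _).trans (add_le_add ?_ ?_)) ?_)
      · simp [abs_of_pos hy, hA]
      · simp [abs_of_pos hy, hB]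
      · simp [hw]
    calc _ ≤ 1 / y * (y * A + y * B + |k| / 2 * (y * V)) := by gcongr
      _ = _ := by field_simp
  have h4 : (1 / y) ^ 2 * ‖Complex.I * y * a - y * b + (k : ℂ) / 2 * w‖ ^ 2 ≤
      3 * (A ^ 2 + B ^ 2 + k ^ 2 / 4 * V ^ 2) := by
    rw [← mul_pow]
    have h5 := pow_le_pow_left₀ (by positivity) h3 2
    have h6 : (|k| / 2 * V) ^ 2 = k ^ 2 / 4 * V ^ 2 := by rw [mul_pow, div_pow, sq_abs]; ring
    nlinarith [sq_nonneg (A - B), sq_nonneg (A - |k| / 2 * V), sq_nonneg (B - |k| / 2 * V)]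
  have hV2 : (1 / y) ^ 2 * ‖w‖ ^ 2 = V ^ 2 := by rw [hV]; ring
  rw [hD, hV2]
  -- The cross terms are absorbed: half of `χ² A²` pays for the drift term and half of `χ² B²` for
  -- the cutoff term, the latter costing `8 V²`. What is left, `χ² (A² + B²) / 2`, explains the
  -- factor 6 against the 3 in `h4`.
  have h7 : -(χ ^ 2 * (A ^ 2 / 2 + k ^ 2 / 2 * V ^ 2)) ≤
      χ ^ 2 * k * (1 / y * (Complex.I * (a * conj w)).re) := by
    rw [mul_assoc, ← mul_neg]
    refine mul_le_mul_of_nonneg_left ?_ (sq_nonneg χ)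
    have : |k * (1 / y * (Complex.I * (a * conj w)).re)| ≤ |k| * (A * V) := by
      rw [abs_mul]; gcongr
    have h8 := (abs_le.mp this).1
    nlinarith [sq_nonneg (A - |k| * V), sq_abs k]
  have h9 : -(χ ^ 2 * (B ^ 2 / 2) + 8 * V ^ 2) ≤ 2 * χ * χ' * (b * conj w).re := by
    have h10 := (abs_le.mp h2).1
    have h11 : 2 * χ * -(2 * B * V) ≤ 2 * χ * (χ' * (b * conj w).re) :=
      mul_le_mul_of_nonneg_left h10 (by positivity)
    nlinarith [sq_nonneg (χ * B - 4 * V)]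
  have hχ2 : χ ^ 2 ≤ 1 := pow_le_one₀ hχ0 hχ1
  have h12 := mul_le_mul_of_nonneg_left h4 (sq_nonneg χ)
  have h13 : χ ^ 2 * ((6 * (k ^ 2 / 2 + c) + 3 * k ^ 2 / 4) * V ^ 2) ≤
      1 * ((6 * (k ^ 2 / 2 + c) + 3 * k ^ 2 / 4) * V ^ 2) :=
    mul_le_mul_of_nonneg_right hχ2 (by positivity)
  linarith

/-- The integrand of the divergence theorem. -/
def caccioppoliDiv (f : ℍ → ℂ) (T : ℝ) (p : ℝ × ℝ) : ℂ :=
  (cutoff T p.2 : ℂ) ^ 2 * ((dx (dx f) (point p.1 p.2) + dy (dy f) (point p.1 p.2)) *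
      conj (f (point p.1 p.2)) + dx f (point p.1 p.2) * conj (dx f (point p.1 p.2)) +
      dy f (point p.1 p.2) * conj (dy f (point p.1 p.2))) +
    2 * cutoff T p.2 * cutoffDeriv T p.2 * (dy f (point p.1 p.2) * conj (f (point p.1 p.2)))

theorem continuousOn_cutoff_rect (T : ℝ) :
    ContinuousOn (fun p : ℝ × ℝ => cutoff T p.2) {p | 0 < p.2} := fun _ hp =>
  ((hasDerivAt_cutoff T hp).continuousAt.comp (f := fun p : ℝ × ℝ => p.2)
    continuousAt_snd).continuousWithinAt

theorem continuousOn_cutoffDeriv_rect (T : ℝ) :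
    ContinuousOn (fun p : ℝ × ℝ => cutoffDeriv T p.2) {p | 0 < p.2} := by
  unfold cutoffDeriv
  have h : ∀ p ∈ {p : ℝ × ℝ | 0 < p.2}, p.2 ≠ 0 := fun _ hp => ne_of_gt hp
  have h2 : ∀ p ∈ {p : ℝ × ℝ | 0 < p.2}, p.2 ^ 2 ≠ 0 := fun p hp => pow_ne_zero 2 (h p hp)
  have c2 : ContinuousOn (fun p : ℝ × ℝ => p.2) {p | 0 < p.2} := continuous_snd.continuousOn
  exact ((continuousOn_const.div (c2.pow 2) h2).mul (continuousOn_const.sub (c2.div_const T))).sub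
    ((continuousOn_const.sub (continuousOn_const.div c2 h)).div_const T)

theorem continuousOn_caccioppoliDiv (hf : SmoothOnUpperHalfPlane f) (T : ℝ) :
    ContinuousOn (caccioppoliDiv f T) {p | 0 < p.2} := by
  have c0 := continuousOn_point hf.continuous
  have c1 := continuousOn_point hf.dx.continuous
  have c2 := continuousOn_point hf.dy.continuous
  have c3 := continuousOn_point hf.dx.dx.continuous
  have c4 := continuousOn_point hf.dy.dy.continuous
  have k0 := Complex.continuous_ofReal.comp_continuousOn (continuousOn_cutoff_rect T)
  have k1 := Complex.continuous_ofReal.comp_continuousOn (continuousOn_cutoffDeriv_rect T)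
  have d0 := Complex.continuous_conj.comp_continuousOn c0
  have d1 := Complex.continuous_conj.comp_continuousOn c1
  have d2 := Complex.continuous_conj.comp_continuousOn c2
  exact ((k0.pow 2).mul ((((c3.add c4).mul d0).add (c1.mul d1)).add (c2.mul d2))).add
    (((continuousOn_const.mul k0).mul k1).mul (c2.mul d0))

/-- The integrand is the divergence of `χ² f̄ ∇f`. The cutoff vanishes on the horizontal sides; the
flux through the two vertical sides agrees because `f̄ ∇f` is periodic when `|u| = 1`. -/
theorem integral_caccioppoliDiv (hf : SmoothOnUpperHalfPlane f) {T : ℝ} (hT : 1 ≤ T) {u : ℂ}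
    (hu : ‖u‖ = 1) (hper : ∀ x y, 0 < y → f (point (x + 1) y) = u * f (point x y)) :
    ∫ p in Set.Icc ((-(1 / 2), 1) : ℝ × ℝ) (1 / 2, T), caccioppoliDiv f T p = 0 := by
  have hpos : ∀ p ∈ Set.Icc ((-(1 / 2), 1) : ℝ × ℝ) (1 / 2, T), 0 < p.2 := fun p hp =>
    lt_of_lt_of_le one_pos hp.1.2
  have hpos' : ∀ p ∈ Set.Ioo (-(1 / 2) : ℝ) (1 / 2) ×ˢ Set.Ioo 1 T, 0 < p.2 := fun p hp =>
    lt_trans one_pos hp.2.1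
  let G1 : ℍ → ℂ := fun z => dx f z * conj (f z)
  let G2 : ℍ → ℂ := fun z => dy f z * conj (f z)
  have hG1 : SmoothOnUpperHalfPlane G1 := hf.dx.mul hf.conj
  have hG2 : SmoothOnUpperHalfPlane G2 := hf.dy.mul hf.conj
  have hχ : ∀ p : ℝ × ℝ, 0 < p.2 → HasFDerivAt (fun p : ℝ × ℝ => cutoff T p.2 ^ 2)
      ((2 * cutoff T p.2 * cutoffDeriv T p.2) • ContinuousLinearMap.snd ℝ ℝ ℝ) p := fun p hp => by
    have h := ((hasDerivAt_cutoff T hp).pow 2).comp_hasFDerivAt p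
      (hasFDerivAt_snd (𝕜 := ℝ) (E := ℝ) (F := ℝ))
    refine HasFDerivAt.congr_fderiv (f := fun p : ℝ × ℝ => cutoff T p.2 ^ 2) h ?_
    simp
  have hP : ∀ p : ℝ × ℝ, 0 < p.2 → HasFDerivAt
      (fun p : ℝ × ℝ => cutoff T p.2 ^ 2 • G1 (point p.1 p.2)) _ p := fun p hp =>
    (hχ p hp).smul (hasFDerivAt_point hG1 p hp)
  have hQ : ∀ p : ℝ × ℝ, 0 < p.2 → HasFDerivAt
      (fun p : ℝ × ℝ => cutoff T p.2 ^ 2 • G2 (point p.1 p.2)) _ p := fun p hp =>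
    (hχ p hp).smul (hasFDerivAt_point hG2 p hp)
  have hI : Complex.equivRealProdCLM.symm ((0, 1) : ℝ × ℝ) = Complex.I := by
    simp [Complex.equivRealProdCLM_symm_apply]
  have h1 : Complex.equivRealProdCLM.symm ((1, 0) : ℝ × ℝ) = 1 := by
    simp [Complex.equivRealProdCLM_symm_apply]
  have hD : ∀ p : ℝ × ℝ, 
      (cutoff T p.2 ^ 2 • (fderiv ℝ (G1 ∘ ofComplex) (point p.1 p.2 : ℂ)).comp
        (Complex.equivRealProdCLM.symm : ℝ × ℝ →L[ℝ] ℂ) +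
        ((2 * cutoff T p.2 * cutoffDeriv T p.2) • ContinuousLinearMap.snd ℝ ℝ ℝ).smulRight
          (G1 (point p.1 p.2))) (1, 0) +
      (cutoff T p.2 ^ 2 • (fderiv ℝ (G2 ∘ ofComplex) (point p.1 p.2 : ℂ)).comp
        (Complex.equivRealProdCLM.symm : ℝ × ℝ →L[ℝ] ℂ) +
        ((2 * cutoff T p.2 * cutoffDeriv T p.2) • ContinuousLinearMap.snd ℝ ℝ ℝ).smulRight
          (G2 (point p.1 p.2))) (0, 1) = caccioppoliDiv f T p := fun p => by
    have e1 : fderiv ℝ (G1 ∘ ofComplex) (point p.1 p.2 : ℂ) 1 = _ :=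
      fderiv_mul_apply hf.dx hf.conj (point p.1 p.2) 1
    have e2 : fderiv ℝ (G2 ∘ ofComplex) (point p.1 p.2 : ℂ) Complex.I = _ :=
      fderiv_mul_apply hf.dy hf.conj (point p.1 p.2) Complex.I
    rw [fderiv_conj_apply hf] at e1 e2
    simp only [add_apply, FunLike.coe_smul, Pi.smul_apply, ContinuousLinearMap.comp_apply,
      ContinuousLinearEquiv.coe_coe, hI, h1, e1, e2, ContinuousLinearMap.smulRight_apply,
      ContinuousLinearMap.coe_snd', smul_eq_mul, mul_zero, zero_smul, mul_one, Complex.real_smul]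
    rw [caccioppoliDiv]
    simp only [G2]
    change _ * (_ * conj (dx f _) + _ * dx (dx f) _) + _ + (_ * (_ * conj (dy f _) + _ * dy (dy f) _) + _) = _
    push_cast
    ring
  have hdiv := integral_divergence_prod_Icc_of_hasFDerivAt_of_le
    (fun p : ℝ × ℝ => cutoff T p.2 ^ 2 • G1 (point p.1 p.2))
    (fun p : ℝ × ℝ => cutoff T p.2 ^ 2 • G2 (point p.1 p.2)) _ _
    (-(1 / 2), 1) (1 / 2, T) ⟨by norm_num, hT⟩
    (fun p hp => (hP p (hpos p hp)).continuousAt.continuousWithinAt)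
    (fun p hp => (hQ p (hpos p hp)).continuousAt.continuousWithinAt)
    (fun p hp => hP p (hpos' p hp)) (fun p hp => hQ p (hpos' p hp))
    (by
      simp only [hD]
      exact ((continuousOn_caccioppoliDiv hf T).mono hpos).integrableOn_compact isCompact_Icc)
  simp only [hD] at hdiv
  rw [hdiv]
  have hT0 : T ≠ 0 := by linarith
  have b1 : cutoff T T = 0 := by simp [cutoff, hT0]
  have b2 : cutoff T 1 = 0 := by simp [cutoff]
  have b3 : ∀ y ∈ Set.uIcc 1 T, cutoff T y ^ 2 • G1 (point (1 / 2) y) =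
      cutoff T y ^ 2 • G1 (point (-(1 / 2)) y) := fun y hy => by
    rw [Set.uIcc_of_le hT] at hy
    have hy0 : 0 < y := lt_of_lt_of_le one_pos hy.1
    have e : (1 / 2 : ℝ) = -(1 / 2) + 1 := by norm_num
    have hux : u * conj u = 1 := by
      rw [Complex.mul_conj, Complex.normSq_eq_norm_sq, hu]; norm_num
    congr 1
    simp only [G1]
    rw [e, dx_point_add_one hf hy0 u (fun x => hper x y hy0), hper _ _ hy0, map_mul]
    rw [← e]
    linear_combination (dx f (point (-(1 / 2)) y) * conj (f (point (-(1 / 2)) y))) * hux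
  simp only [b1, b2]
  rw [intervalIntegral.integral_congr b3]
  simp

/-- Integrating `caccioppoli_pointwise` over a rectangle removes the divergence and leaves a bound
by the norm of `f`, independent of the height `T`. Exhausting the strip by such rectangles gives
integrability. -/
theorem integrableOn_fd_lower (hf : SmoothOnUpperHalfPlane f) {k : ℤ} {c : ℝ} (hc : 0 ≤ c)
    (heig : ∀ z, laplacian k f z + c * f z = 0) {u : ℂ} (hu : ‖u‖ = 1)
    (hper : ∀ x y, 0 < y → f (point (x + 1) y) = u * f (point x y))
    (hint : IntegrableOn (fun z : ℍ => ‖f z‖ ^ 2) ModularGroup.fd) :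
    IntegrableOn (fun z : ℍ => ‖lower k f z‖ ^ 2) ModularGroup.fd := by
  have hL := (hf.lower k).continuous
  refine integrableOn_fd_of_halfStrip (hL.norm.pow 2) ?_
  have hA := integrableOn_halfStrip_of_fd hint
  set FA : ℝ × ℝ → ℝ := fun p => (1 / p.2) ^ 2 * ‖f (point p.1 p.2)‖ ^ 2 with hFA
  set FL : ℝ × ℝ → ℝ := fun p => (1 / p.2) ^ 2 * ‖lower k f (point p.1 p.2)‖ ^ 2 with hFL
  have hFA0 : ∀ p, 0 ≤ FA p := fun p => by positivity
  have hFL0 : ∀ p, 0 ≤ FL p := fun p => by positivity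
  have cinv : ContinuousOn (fun p : ℝ × ℝ => (1 / p.2) ^ 2) {p | 0 < p.2} :=
    (continuousOn_const.div continuous_snd.continuousOn fun p hp => ne_of_gt hp).pow 2
  have cFL : ContinuousOn FL {p | 0 < p.2} := cinv.mul ((continuousOn_point hL).norm.pow 2)
  have cFA : ContinuousOn FA {p | 0 < p.2} :=
    cinv.mul ((continuousOn_point hf.continuous).norm.pow 2)
  set K : ℝ := 6 * ((k : ℝ) ^ 2 / 2 + c + 8) + 3 * (k : ℝ) ^ 2 / 4 with hK
  have hK0 : 0 ≤ K := by positivity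
  have hrect : ∀ T : ℝ, 1 ≤ T → ∫ p in Set.Icc ((-(1 / 2), 1) : ℝ × ℝ) (1 / 2, T),
      cutoff T p.2 ^ 2 * FL p ≤ K * ∫ p in halfStrip 1, FA p := fun T hT => by
    have hpos : Set.Icc ((-(1 / 2), 1) : ℝ × ℝ) (1 / 2, T) ⊆ {p | 0 < p.2} := fun p hp =>
      lt_of_lt_of_le one_pos hp.1.2
    have hsub : Set.Icc ((-(1 / 2), 1) : ℝ × ℝ) (1 / 2, T) ⊆ halfStrip 1 := fun p hp =>
      ⟨⟨hp.1.1, hp.2.1⟩, hp.1.2⟩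
    have i1 := (((continuousOn_cutoff_rect T).pow 2).mul cFL |>.mono hpos).integrableOn_compact
      (μ := volume) isCompact_Icc
    have i2 := ((continuousOn_caccioppoliDiv hf T).mono hpos).integrableOn_compact
      (μ := volume) isCompact_Icc
    have i3 := hA.mono_set hsub
    have i4 : IntegrableOn (fun p => (caccioppoliDiv f T p).re)
      (Set.Icc ((-(1 / 2), 1) : ℝ × ℝ) (1 / 2, T)) := i2.re
    have h0 : ∫ p in Set.Icc ((-(1 / 2), 1) : ℝ × ℝ) (1 / 2, T), (caccioppoliDiv f T p).re = 0 := by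
      have := Complex.reCLM.integral_comp_comm i2
      rw [integral_caccioppoliDiv hf hT hu hper] at this
      simpa using this
    calc ∫ p in Set.Icc ((-(1 / 2), 1) : ℝ × ℝ) (1 / 2, T), cutoff T p.2 ^ 2 * FL p
        ≤ ∫ p in Set.Icc ((-(1 / 2), 1) : ℝ × ℝ) (1 / 2, T),
            (6 * (caccioppoliDiv f T p).re + K * FA p) := by
          refine setIntegral_mono_on i1 ((i4.const_mul 6).add (i3.const_mul K))
            measurableSet_Icc fun p hp => ?_
          have hp0 : 0 < p.2 := hpos hp
          obtain ⟨c0, c1⟩ := cutoff_mem hp.1.2 hp.2.2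
          have hs := heig (point p.1 p.2)
          rw [laplacian, im_point _ hp0] at hs
          have := caccioppoli_pointwise (a := dx f (point p.1 p.2)) (b := dy f (point p.1 p.2))
            (w := f (point p.1 p.2)) (k := (k : ℝ)) (χ := cutoff T p.2) (χ' := cutoffDeriv T p.2)
            hp0 c0 c1 (abs_mul_cutoffDeriv_le hp.1.2 hp.2.2) hc (by push_cast; exact hs)
          simp only [hFL, lower_apply, imC_point _ hp0]
          rw [Complex.ofReal_intCast] at this
          exact this
      _ = K * ∫ p in Set.Icc ((-(1 / 2), 1) : ℝ × ℝ) (1 / 2, T), FA p := by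
          rw [integral_add (i4.const_mul 6) (i3.const_mul K), integral_const_mul,
            integral_const_mul, h0]
          ring
      _ ≤ K * ∫ p in halfStrip 1, FA p := by
          refine mul_le_mul_of_nonneg_left ?_ hK0
          exact setIntegral_mono_set hA (Filter.Eventually.of_forall hFA0)
            (Filter.Eventually.of_forall hsub)
  let φ : ℕ → Set (ℝ × ℝ) := fun n => {p | p.2 ≤ n}
  have hφm : ∀ n, MeasurableSet (φ n) := fun n => measurableSet_le measurable_snd measurable_const
  have hφ : AECover (volume.restrict (halfStrip 2)) Filter.atTop φ :=
    ⟨Filter.Eventually.of_forall fun p => by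
      filter_upwards [Filter.eventually_ge_atTop ⌈p.2⌉₊] with n hn
      exact (Nat.le_ceil p.2).trans (by exact_mod_cast hn), hφm⟩
  have hset : ∀ n, φ n ∩ halfStrip 2 = Set.Icc ((-(1 / 2), 2) : ℝ × ℝ) (1 / 2, n) := fun n => by
    ext p
    constructor
    · rintro ⟨h1, h2, h3⟩
      exact ⟨⟨h2.1, h3⟩, ⟨h2.2, h1⟩⟩
    · rintro ⟨h1, h2⟩
      exact ⟨h2.2, ⟨h1.1, h2.1⟩, h1.2⟩
  -- The cutoff is at least `1/4` on `2 ≤ y ≤ T/2`, so its square costs a factor 16; the height `T =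
  -- 2n` covers the rectangle up to `n`.
  refine hφ.integrable_of_integral_norm_bounded (16 * (K * ∫ p in halfStrip 1, FA p))
    (fun n => ?_) (Filter.eventually_atTop.mpr ⟨2, fun n hn => ?_⟩)
  · rw [IntegrableOn, Measure.restrict_restrict (hφm n), hset]
    exact (cFL.mono fun p hp => lt_of_lt_of_le two_pos hp.1.2).integrableOn_compact isCompact_Icc
  · rw [Measure.restrict_restrict (hφm n), hset]
    have hn' : (2 : ℝ) ≤ n := by exact_mod_cast hn
    have hT : (1 : ℝ) ≤ 2 * n := by linarith
    refine le_trans ?_ (mul_le_mul_of_nonneg_left (hrect (2 * n) hT) (by norm_num))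
    rw [← integral_const_mul]
    have hpos : Set.Icc ((-(1 / 2), 1) : ℝ × ℝ) (1 / 2, 2 * (n : ℝ)) ⊆ {p | 0 < p.2} := fun p hp =>
      lt_of_lt_of_le one_pos hp.1.2
    have hsub : Set.Icc ((-(1 / 2), 2) : ℝ × ℝ) (1 / 2, (n : ℝ)) ⊆
        Set.Icc ((-(1 / 2), 1) : ℝ × ℝ) (1 / 2, 2 * (n : ℝ)) :=
      Set.Icc_subset_Icc ⟨le_rfl, one_le_two⟩ ⟨le_rfl, by simp only; linarith⟩
    have i1 := ((((continuousOn_cutoff_rect (2 * n)).pow 2).mul cFL).const_mul 16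
      |>.mono hpos).integrableOn_compact (μ := volume) isCompact_Icc
    refine le_trans ?_ (setIntegral_mono_set i1 (Filter.Eventually.of_forall fun p => ?_)
      (Filter.Eventually.of_forall hsub))
    · refine setIntegral_mono_on ?_ (i1.mono_set hsub) measurableSet_Icc fun p hp => ?_
      · exact (cFL.mono fun p hp => lt_of_lt_of_le two_pos hp.1.2).norm.integrableOn_compact
          isCompact_Icc
      · have hq := quarter_le_cutoff (T := 2 * n) hp.1.2 (by have := hp.2.2; simp only at this; linarith)
        rw [Real.norm_of_nonneg (hFL0 p)]
        have : 1 ≤ 16 * cutoff (2 * n) p.2 ^ 2 := by nlinarith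
        calc FL p ≤ (16 * cutoff (2 * n) p.2 ^ 2) * FL p := le_mul_of_one_le_left (hFL0 p) this
          _ = _ := by ring
    · have := hFL0 p
      positivity

end Caccioppoli

/-! ### Maass waveforms and the bijections. -/

section MaassSpace

variable {k : ℕ} {R : ℝ} {v v' : SL(2, ℤ) → ℂ} {f : ℍ → ℂ}

theorem unitFactor_T (w : ℂ) : unitFactor ModularGroup.T w = 1 := by
  rw [unitFactor, denom_eq]
  simp [ModularGroup.T]

theorem IsMaassWaveform.smul_eq {k : ℤ} (hf : IsMaassWaveform k v R f) (g : SL(2, ℤ)) (z : ℍ) :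
    f (g • z) = v g * unitFactor g z ^ k * f z :=
  (slash_eq_iff k g f (v g) z).mp (hf.slash_eq g z)

theorem IsMaassWaveform.point_add_one {k : ℤ} (hf : IsMaassWaveform k v R f) (x y : ℝ)
    (hy : 0 < y) : f (point (x + 1) y) = v ModularGroup.T * f (point x y) := by
  rw [EtaMaass.point_add_one x hy, ← modular_T_smul, hf.smul_eq, unitFactor_T, one_zpow, mul_one]

theorem IsMaassWaveform.lowerIter_sq_integrable {k : ℤ} (hf : IsMaassWaveform k v R f)
    (hv : ‖v ModularGroup.T‖ = 1) (m : ℕ) :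
    MeasureTheory.IntegrableOn (fun z : ℍ => ‖lowerIter k m f z‖ ^ 2) ModularGroup.fd := by
  have hs : SmoothOnUpperHalfPlane f := hf.smooth
  induction m with
  | zero => exact hf.sq_integrable
  | succ m ih =>
    refine integrableOn_fd_lower (hs.lowerIter k m) (c := 1 / 4 + R ^ 2) (by positivity)
      (fun z => ?_) hv (lowerIter_point_add_one hs _ hf.point_add_one k m) ih
    have := laplacian_lowerIter hs k _ hf.eigen m z
    push_cast
    exact this

/-- `Θ` maps Maass waveforms to Maass waveforms for the reflected multiplier system. -/
theorem IsMaassWaveform.Theta (hf : IsMaassWaveform k v R f) (hv : ‖v ModularGroup.T‖ = 1)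
    (hv' : ∀ g, v (mirrorConj g) = v' g) : IsMaassWaveform k v' R (Theta k f) := by
  have hs : SmoothOnUpperHalfPlane f := hf.smooth
  have hsk := hs.lowerIter k k
  have hw : (k : ℤ) - 2 * (k : ℤ) = -k := by ring
  refine ⟨hs.Theta k, fun g z => ?_, fun z => ?_, ?_⟩
  · have h := fun g => lowerIter_smul hs g k (v g) (hf.smul_eq g) k
    rw [hw] at h
    have := reflect_smul v h g z
    rw [neg_neg, hv'] at this
    exact (slash_eq_iff k g _ _ z).mpr this
  · have h := laplacian_lowerIter hs k _ hf.eigen k (mirror z)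
    rw [hw] at h
    rw [EtaMaass.Theta, laplacian_reflect hsk]
    exact h
  · exact integrableOn_fd_reflect (hf.lowerIter_sq_integrable hv k)

theorem IsMaassWaveform.const_mul {k : ℤ} (hf : IsMaassWaveform k v R f) (c : ℂ) :
    IsMaassWaveform k v R (fun z => c * f z) := by
  have hs : SmoothOnUpperHalfPlane f := hf.smooth
  refine ⟨hs.const_mul c, fun g z => ?_, fun z => ?_, ?_⟩
  · rw [slash_eq_iff, hf.smul_eq]; ring
  · have h1 : dx (fun z => c * f z) = fun z => c * dx f z := funext (dx_const_mul hs c)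
    have h2 : dy (fun z => c * f z) = fun z => c * dy f z := funext (dy_const_mul hs c)
    rw [laplacian, h1, h2, dx_const_mul hs.dx, dy_const_mul hs.dy]
    have := hf.eigen z
    rw [laplacian] at this
    linear_combination c * this
  · simp only [norm_mul, mul_pow]
    exact MeasureTheory.Integrable.const_mul hf.sq_integrable (‖c‖ ^ 2)

/-- `Θ` maps each of the two spaces into the other and its square is the nonzero scalar `Λ` on both;
this gives injectivity, and `Λ⁻¹ Θ g` is a preimage of `g`. -/
theorem bijOn_Theta (hR : R ≠ 0) (hv : ‖v ModularGroup.T‖ = 1) (hv' : ‖v' ModularGroup.T‖ = 1)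
    (h : ∀ g, v (mirrorConj g) = v' g) (h' : ∀ g, v' (mirrorConj g) = v g) :
    Set.BijOn (Theta k) (maassSpace k v R) (maassSpace k v' R) := by
  have hL : (Lam k R : ℂ) ≠ 0 := by exact_mod_cast Lam_ne_zero k hR
  refine ⟨fun f hf => IsMaassWaveform.Theta hf hv h, fun f hf g hg hfg => ?_, fun g hg => ?_⟩
  · have e1 := Theta_Theta hf.smooth k R hf.eigen
    have e2 := Theta_Theta hg.smooth k R hg.eigen
    rw [hfg, e2] at e1
    exact (smul_right_injective _ hL e1).symm
  · have hT := IsMaassWaveform.Theta hg hv' h'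
    refine ⟨fun z => (Lam k R : ℂ)⁻¹ * Theta k g z, hT.const_mul _, ?_⟩
    rw [Theta_const_mul hT.smooth, Theta_Theta hg.smooth k R hg.eigen]
    funext z
    simp [hL]

end MaassSpace

end

end EtaMaass

theorem mainTheorem7 (k : ℕ) (hk1 : 1 ≤ k) (hk11 : k ≤ 11) (R : ℝ) (hR : R ≠ 0) :
    Set.BijOn (EtaMaass.Theta k)
      (EtaMaass.maassSpace k (EtaMaass.etaSystem k) R)
      (EtaMaass.maassSpace k (EtaMaass.etaSystemConj k) R) ∧
    Set.BijOn (EtaMaass.Theta k)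
      (EtaMaass.maassSpace k (EtaMaass.etaSystemConj k) R)
      (EtaMaass.maassSpace k (EtaMaass.etaSystem k) R) ∧
    (∀ f ∈ EtaMaass.maassSpace k (EtaMaass.etaSystem k) R ∪
        EtaMaass.maassSpace k (EtaMaass.etaSystemConj k) R,
      EtaMaass.Theta k (EtaMaass.Theta k f) = (EtaMaass.Lam k R : ℂ) • f) ∧
    (∀ f ∈ EtaMaass.maassSpace k (EtaMaass.etaSystem k) R, ∀ c : ℤ → ℂ,
      (∀ z : UpperHalfPlane, HasSum (fun n : ℤ => c n * EtaMaass.expansionTerm n k R z) (f z)) →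
      ∀ z : UpperHalfPlane,
        HasSum (fun n : ℤ =>
          (if 1 ≤ n then (1 : ℂ) else (EtaMaass.Lam k R : ℂ)) * c (-n) *
            EtaMaass.expansionTermConj n k R z) (EtaMaass.Theta k f z)) := by
  have h1 := EtaMaass.etaSystem_mirrorConj k
  have h2 := EtaMaass.etaSystemConj_mirrorConj k
  have n1 := EtaMaass.norm_etaSystem k ModularGroup.T
  have n2 := EtaMaass.norm_etaSystemConj k ModularGroup.T
  refine ⟨EtaMaass.bijOn_Theta hR n1 n2 h1 h2, EtaMaass.bijOn_Theta hR n2 n1 h2 h1, ?_, ?_⟩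
  · rintro f (hf | hf)
    · exact EtaMaass.Theta_Theta hf.smooth k R hf.eigen
    · exact EtaMaass.Theta_Theta hf.smooth k R hf.eigen
  · exact fun f hf c hc z => EtaMaass.hasSum_Theta hf.smooth hk1 hk11 hR c hc z
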